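/- Let $H$ be an infinite-dimensional complex Hilbert space, let $B(H)$ be the set of bounded linear operators on $H$, and let $B_+(H)$ be the cone of positive operators, i.e. of those $A\in B(H)$ with $\langle Ax,x\rangle\ge 0$ for all $x\in H$, ordered by $A\le B$ iff $B-A\in B_+(H)$. For $A,B\in B_+(H)$: - $A$ and $B$ are singular, $A\perp B$, if the only $C\in B_+(H)$ with $C\le A$ and $C\le B$ is $C=0$; - $A$ is $B$-absolutely continuous, $A\ll B$, if there is an increasing sequence $C_1\le C_2\le\cdots$ in $B_+(H)$ that converges to $A$ in the strong operator topology and such that for every $n$ there is a real $c_n\ge 0$ with $C_n\le c_nB$. For a bounded linear or conjugate-linear operator $T$ on $H$, $T^*$ denotes its adjoint; for conjugate-linear $T$ it is the bounded conjugate-linear operator with $\langle Tx,y\rangle=\overline{\langle x,T^*y\rangle}$ for all $x,y\in H$. Let $\varphi:B_+(H)\to B_+(H)$ be a bijection. Then the following four statements are equivalent: (i) for all $A,B\in B_+(H)$: $A\ll B$ if and only if $\varphi(A)\ll\varphi(B)$; (ii) for all $A,B\in B_+(H)$: $A\perp B$ if and only if $\varphi(A)\perp\varphi(B)$; (iii)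 there is a bounded invertible operator $T:H\to H$, linear or conjugate-linear, such that $\operatorname{ran}\varphi(A)^{1/2}=\operatorname{ran}TA^{1/2}$ for all $A\in B_+(H)$; (iv) there are a bounded invertible operator $T:H\to H$, linear or conjugate-linear, and a family $\{Z_A : A\in B_+(H)\}$ of invertible positive operators in $B(H)$ such that $\varphi(A)=(TAT^*)^{1/2}Z_A(TAT^*)^{1/2}$ for all $A\in B_+(H)$. -/

import Mathlib

open Filter Topology
open scoped ComplexConjugate InnerProductSpace

noncomputable section

/-- The cone of bounded positive operators on a complex Hilbert space. -/
abbrev PosOp (H : Type*) [NormedAddCommGroup H] [InnerProductSpace ℂ H] [CompleteSpace H] :=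
  {A : H →L[ℂ] H // A.IsPositive}

section Relations

variable {H : Type*} [NormedAddCommGroup H] [InnerProductSpace ℂ H] [CompleteSpace H]

/-- `A` and `B` are singular: the only positive operator below both of them is `0`. -/
def Singular (A B : PosOp H) : Prop :=
  ∀ C : PosOp H, C ≤ A → C ≤ B → (C : H →L[ℂ] H) = 0

/-- `A` is `B`-dominated: `A ≤ c B` for some real `c ≥ 0`. -/
def Dominated (A B : PosOp H) : Prop :=
  ∃ c : ℝ, 0 ≤ c ∧ (A : H →L[ℂ] H) ≤ c • (B : H →L[ℂ] H)

/-- `A` is `B`-absolutely continuous: `A` is the limit, in the strong operator topology, of a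
monotone increasing sequence of `B`-dominated positive operators. -/
def AbsCont (A B : PosOp H) : Prop :=
  ∃ C : ℕ → PosOp H, Monotone C ∧ (∀ n, Dominated (C n) B) ∧
    ∀ x : H, Tendsto (fun n => (C n : H →L[ℂ] H) x) atTop (𝓝 ((A : H →L[ℂ] H) x))

/-- The positive square root of a bounded positive operator. -/
abbrev opSqrt (A : H →L[ℂ] H) : H →L[ℂ] H := CFC.sqrt A

/-- The adjoint of a bounded conjugate-linear operator `T`: the bounded conjugate-linear operator
`T*` with `⟪T* y, x⟫ = ⟪T x, y⟫` for all `x`, `y`. -/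
def conjAdjoint (T : H →L⋆[ℂ] H) : H →L⋆[ℂ] H :=
  ((InnerProductSpace.toDual ℂ H).symm.toContinuousLinearEquiv :
      (H →L[ℂ] ℂ) →L⋆[ℂ] H).comp
    ((innerSL ℂ : H →L⋆[ℂ] H →L[ℂ] ℂ).comp T).flip

theorem conjAdjoint_inner (T : H →L⋆[ℂ] H) (x y : H) :
    ⟪conjAdjoint T y, x⟫_ℂ = ⟪T x, y⟫_ℂ := by
  simp [conjAdjoint]

/-- The linear operator `T A T*` for a bounded linear `T`. -/
def conjugateLin (T : H →L[ℂ] H) (A : H →L[ℂ] H) : H →L[ℂ] H :=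
  T ∘L A ∘L ContinuousLinearMap.adjoint T

/-- The linear operator `T A T*` for a bounded conjugate-linear `T`. -/
def conjugateConj (T : H →L⋆[ℂ] H) (A : H →L[ℂ] H) : H →L[ℂ] H :=
  T.comp (A.comp (conjAdjoint T))

end Relations

end

/-! Everything reduces to the root ranges ran A^{1/2}. By Douglas' argument A ≤ cB for some c iff
ran A^{1/2} ⊆ ran B^{1/2} (`dominated_iff_rootRange_le`). Singularity means that root ranges meet
trivially (`singular_iff_disjoint`), and A ≪ B means that the form of A is closable with respect to
that of B (`absCont_iff_formClosable`).

Both (i) and (ii) force φ to preserve inclusion of root ranges in both directions: this inclusion is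
definable from ⊥, and also from ≪ after the rank-one operators have been recognised. Such a φ
permutes the lines of H and respects planes, so the fundamental theorem of projective geometry
(`IsCollineation.exists_semilinear`) yields a semilinear bijection T that carries root ranges to
root ranges.

Boundedness of T comes from closed hyperplanes, which are root ranges of projections. Each x ↦
σ⁻¹⟨z, Tx⟩ has an operator range as kernel, hence is continuous. In infinite dimension a gliding
hump then makes σ⁻¹ continuous, so σ is the identity or conjugation, and the closed graph theorem
applies.

Conversely TAT* has root range T(ran A^{1/2}), so (iii) says that φ(A) and TAT* have equal root
ranges. That is (iv) by `rootRange_eq_iff_exists_isUnit`. It gives (i) and (ii) because closability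
is stable under equivalent seminorms and the substitution T*, and T preserves trivial intersections.
-/

noncomputable section

/-! ### Order and quadratic forms. -/

section QuadraticForm

variable {H : Type*} [NormedAddCommGroup H] [InnerProductSpace ℂ H]

/-- The order between symmetric operators is the order between their quadratic forms. -/
theorem le_iff_re_inner {A B : H →L[ℂ] H} (hA : A.IsPositive) (hB : B.IsPositive) :
    A ≤ B ↔ ∀ x, (⟪A x, x⟫_ℂ).re ≤ (⟪B x, x⟫_ℂ).re := by
  rw [ContinuousLinearMap.le_def, ContinuousLinearMap.isPositive_def]
  constructor
  · rintro ⟨-, h⟩ x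
    have := h x
    simp only [ContinuousLinearMap.reApplyInnerSelf_apply, sub_apply,
      inner_sub_left, map_sub] at this
    exact sub_nonneg.1 this
  · intro h
    refine ⟨by simpa using hB.isSymmetric.sub hA.isSymmetric, fun x => ?_⟩
    simp only [ContinuousLinearMap.reApplyInnerSelf_apply, sub_apply,
      inner_sub_left, map_sub]
    exact sub_nonneg.2 (h x)

theorem real_smul_isPositive {A : H →L[ℂ] H} (hA : A.IsPositive) {c : ℝ} (hc : 0 ≤ c) :
    (c • A).IsPositive := by
  have := hA.smul_of_nonneg (c := (c : ℂ)) (by exact_mod_cast hc)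
  simpa using this

theorem re_inner_real_smul (A : H →L[ℂ] H) (c : ℝ) (x : H) :
    (⟪(c • A) x, x⟫_ℂ).re = c * (⟪A x, x⟫_ℂ).re := by
  rw [smul_apply, ← Complex.coe_smul, inner_smul_left, Complex.conj_ofReal, Complex.re_ofReal_mul]

end QuadraticForm

/-! ### Root ranges, domination and singularity. -/

section RootRange

variable {H : Type*} [NormedAddCommGroup H] [InnerProductSpace ℂ H] [CompleteSpace H]

/-- The range of the square root of a positive operator. -/
def rootRange (A : PosOp H) : Submodule ℂ H := (opSqrt A.1).range

theorem coe_rootRange (A : PosOp H) : (rootRange A : Set H) = Set.range (opSqrt A.1) := rfl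

theorem opSqrt_isPositive (A : H →L[ℂ] H) : (opSqrt A).IsPositive :=
  (ContinuousLinearMap.nonneg_iff_isPositive _).1 (CFC.sqrt_nonneg A)

theorem opSqrt_opSqrt {A : H →L[ℂ] H} (hA : A.IsPositive) (x : H) :
    opSqrt A (opSqrt A x) = A x :=
  DFunLike.congr_fun
    (CFC.sqrt_mul_sqrt_self A ((ContinuousLinearMap.nonneg_iff_isPositive _).2 hA)) x

theorem inner_opSqrt_left (A : H →L[ℂ] H) (x y : H) :
    ⟪opSqrt A x, y⟫_ℂ = ⟪x, opSqrt A y⟫_ℂ :=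
  (opSqrt_isPositive A).inner_left_eq_inner_right x y

theorem norm_opSqrt_sq {A : H →L[ℂ] H} (hA : A.IsPositive) (x : H) :
    ‖opSqrt A x‖ ^ 2 = (⟪A x, x⟫_ℂ).re := by
  rw [← opSqrt_opSqrt hA, inner_opSqrt_left, inner_self_eq_norm_sq_to_K]
  norm_cast

theorem opSqrt_apply_eq_zero_iff {A : H →L[ℂ] H} (hA : A.IsPositive) {x : H} :
    opSqrt A x = 0 ↔ A x = 0 := by
  constructor
  · intro h
    rw [← opSqrt_opSqrt hA, h, map_zero]
  · intro h
    have := norm_opSqrt_sq hA x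
    rw [h, inner_zero_left] at this
    simpa using this

theorem opSqrt_eq_of_sq {A B : H →L[ℂ] H} (hB : B.IsPositive) (h : B * B = A) :
    opSqrt A = B := by
  have hB' := (ContinuousLinearMap.nonneg_iff_isPositive _).2 hB
  subst h
  exact CFC.sqrt_mul_self B hB'

theorem posOp_le_iff (A B : PosOp H) : A ≤ B ↔ ∀ x, ‖opSqrt A.1 x‖ ≤ ‖opSqrt B.1 x‖ := by
  rw [← Subtype.coe_le_coe, le_iff_re_inner A.2 B.2]
  refine forall_congr' fun x => ?_
  rw [← norm_opSqrt_sq A.2, ← norm_opSqrt_sq B.2]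
  exact sq_le_sq₀ (norm_nonneg _) (norm_nonneg _)

theorem dominated_iff_norm_le (A B : PosOp H) :
    Dominated A B ↔ ∃ c : ℝ, 0 ≤ c ∧ ∀ x, ‖opSqrt A.1 x‖ ≤ c * ‖opSqrt B.1 x‖ := by
  constructor
  · rintro ⟨c, hc, h⟩
    refine ⟨√c, Real.sqrt_nonneg c, fun x => ?_⟩
    have := (le_iff_re_inner A.2 (real_smul_isPositive B.2 hc)).1 h x
    rw [re_inner_real_smul, ← norm_opSqrt_sq A.2, ← norm_opSqrt_sq B.2] at this
    refine le_of_sq_le_sq ?_ (by positivity)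
    rwa [mul_pow, Real.sq_sqrt hc]
  · rintro ⟨c, hc, h⟩
    refine ⟨c ^ 2, by positivity, ?_⟩
    rw [le_iff_re_inner A.2 (real_smul_isPositive B.2 (by positivity))]
    intro x
    rw [re_inner_real_smul, ← norm_opSqrt_sq A.2, ← norm_opSqrt_sq B.2, ← mul_pow]
    exact pow_le_pow_left₀ (norm_nonneg _) (h x) 2

/-- A vector is in the range of `√A` iff the functional it represents is bounded by `‖√A x‖`. -/
theorem mem_rootRange_iff {A : PosOp H} {y : H} :
    y ∈ rootRange A ↔ ∃ c : ℝ, ∀ x, ‖⟪y, x⟫_ℂ‖ ≤ c * ‖opSqrt A.1 x‖ := by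
  constructor
  · rintro ⟨u, rfl⟩
    exact ⟨‖u‖, fun x => (congrArg norm (inner_opSqrt_left A.1 u x)).trans_le
      (norm_inner_le_norm _ _)⟩
  · rintro ⟨c, hc⟩
    set S := opSqrt A.1
    -- An arbitrary linear section of `S`. The value ⟨y, g v⟩ does not depend on it, because `hc`
    -- makes y vanish on ker `S`. Hahn–Banach and Riesz then produce the preimage of y.
    obtain ⟨g, hg⟩ := S.toLinearMap.rangeRestrict.exists_rightInverse_of_surjective
      S.toLinearMap.range_rangeRestrict
    have hg' : ∀ v : S.toLinearMap.range, S (g v) = v := fun v => by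
      simpa using congrArg Subtype.val (DFunLike.congr_fun hg v)
    let f : S.toLinearMap.range →L[ℂ] ℂ :=
      LinearMap.mkContinuous ((innerSL ℂ y).toLinearMap ∘ₗ g) c fun v => by
        have := hc (g v)
        rw [hg' v] at this
        simpa using this
    obtain ⟨F, hF, -⟩ := exists_extension_norm_eq _ f
    refine ⟨(InnerProductSpace.toDual ℂ H).symm F, ?_⟩
    refine ext_inner_right ℂ fun x => ?_
    change ⟪S _, x⟫_ℂ = _
    rw [inner_opSqrt_left, InnerProductSpace.toDual_symm_apply]
    have h1 := hF ⟨S x, x, rfl⟩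
    have h2 : f ⟨S x, x, rfl⟩ = ⟪y, g ⟨S x, x, rfl⟩⟫_ℂ := rfl
    have h3 := hc (x - g ⟨S x, x, rfl⟩)
    rw [map_sub, hg', sub_self, norm_zero, mul_zero, norm_le_zero_iff, inner_sub_right,
      sub_eq_zero] at h3
    rw [h3, ← h2, ← h1]

/-- Domination of positive operators is inclusion of the ranges of their square roots. -/
theorem dominated_iff_rootRange_le {A B : PosOp H} :
    Dominated A B ↔ rootRange A ≤ rootRange B := by
  rw [dominated_iff_norm_le]
  constructor
  · rintro ⟨c, hc, h⟩ y hy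
    obtain ⟨d, hd⟩ := mem_rootRange_iff.1 hy
    refine mem_rootRange_iff.2 ⟨|d| * c, fun x => (hd x).trans ?_⟩
    rw [mul_assoc]
    exact mul_le_mul (le_abs_self d) (h x) (norm_nonneg _) (abs_nonneg d)
  · intro h
    -- Uniform boundedness over all x with ‖√B x‖ ≤ 1: since √A u lies in ran √B, the functionals
    -- ⟨√A x, ·⟩ are bounded at each u.
    obtain ⟨C, hC⟩ := banach_steinhaus
      (g := fun x : {x : H // ‖opSqrt B.1 x‖ ≤ 1} => innerSL ℂ (opSqrt A.1 x)) (by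
        intro u
        obtain ⟨c, hc⟩ := mem_rootRange_iff.1 (h ⟨u, rfl⟩)
        refine ⟨|c|, fun x => ?_⟩
        have h1 := hc x.1
        change ‖⟪opSqrt A.1 x, u⟫_ℂ‖ ≤ _
        rw [norm_inner_symm]
        refine ((congrArg norm (inner_opSqrt_left A.1 u x.1)).symm.trans_le h1).trans ?_
        calc c * ‖opSqrt B.1 x‖ ≤ |c| * 1 :=
              mul_le_mul (le_abs_self c) x.2 (norm_nonneg _) (abs_nonneg c)
          _ = |c| := mul_one _)
    have hC' : ∀ x, ‖opSqrt B.1 x‖ ≤ 1 → ‖opSqrt A.1 x‖ ≤ C := fun x hx => by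
      simpa using hC ⟨x, hx⟩
    have hC0 : 0 ≤ C := (norm_nonneg _).trans (hC' 0 (by simp))
    refine ⟨C, hC0, fun x => ?_⟩
    -- ‖√B x‖ may vanish, so x is rescaled by a slightly larger t > 0 instead.
    refine le_of_forall_pos_le_add fun ε hε => ?_
    have key : ∀ t : ℝ, ‖opSqrt B.1 x‖ < t → ‖opSqrt A.1 x‖ ≤ C * t := fun t ht => by
      have ht0 : 0 < t := (norm_nonneg _).trans_lt ht
      have := hC' ((t : ℂ)⁻¹ • x) (by
        rw [map_smul, norm_smul, norm_inv, Complex.norm_real, Real.norm_of_nonneg ht0.le,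
          inv_mul_le_iff₀ ht0, mul_one]
        exact ht.le)
      rwa [map_smul, norm_smul, norm_inv, Complex.norm_real, Real.norm_of_nonneg ht0.le,
        inv_mul_le_iff₀ ht0, mul_comm] at this
    have h1 := key (‖opSqrt B.1 x‖ + ε / (C + 1)) (by
      have : 0 < ε / (C + 1) := by positivity
      linarith)
    refine h1.trans ?_
    rw [mul_add, add_le_add_iff_left, mul_div_assoc', div_le_iff₀ (by positivity)]
    nlinarith

/-- The orthogonal projection onto a complete subspace as a positive operator. -/
def projOp (K : Submodule ℂ H) [K.HasOrthogonalProjection] : PosOp H :=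
  ⟨K.starProjection, ContinuousLinearMap.IsPositive.of_isStarProjection
    isStarProjection_starProjection⟩

@[simp] theorem rootRange_projOp (K : Submodule ℂ H) [K.HasOrthogonalProjection] :
    rootRange (projOp K) = K := by
  have : opSqrt (projOp K).1 = K.starProjection :=
    opSqrt_eq_of_sq (projOp K).2 K.isIdempotentElem_starProjection
  rw [rootRange, this]
  exact K.range_starProjection

theorem rootRange_eq_bot_iff {A : PosOp H} : rootRange A = ⊥ ↔ A.1 = 0 := by
  constructor
  · intro h
    ext x
    rw [← opSqrt_opSqrt A.2]
    have : opSqrt A.1 x ∈ rootRange A := ⟨x, rfl⟩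
    rw [h, Submodule.mem_bot] at this
    simp [this]
  · intro h
    refine (Submodule.eq_bot_iff _).2 ?_
    rintro _ ⟨x, rfl⟩
    exact (opSqrt_apply_eq_zero_iff A.2).2 (by simp [h])

/-- A nonzero vector common to both root ranges spans a line whose projection is dominated by both
operators, so a small multiple of it lies below both. -/
theorem singular_iff_disjoint {A B : PosOp H} :
    Singular A B ↔ Disjoint (rootRange A) (rootRange B) := by
  constructor
  · intro h
    rw [Submodule.disjoint_def]
    intro y hyA hyB
    by_contra hy
    have hle : ∀ D : PosOp H, y ∈ rootRange D → Dominated (projOp (ℂ ∙ y)) D := fun D hD => by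
      rw [dominated_iff_rootRange_le, rootRange_projOp]
      simpa using hD
    obtain ⟨a, ha, hA⟩ := hle A hyA
    obtain ⟨b, hb, hB⟩ := hle B hyB
    set P := projOp (ℂ ∙ y)
    have ht : 0 ≤ (a + b + 1)⁻¹ := by positivity
    have hsmul : ∀ (D : PosOp H) (d : ℝ), d ≤ a + b + 1 → 0 ≤ d → P.1 ≤ d • D.1 →
        (⟨(a + b + 1)⁻¹ • P.1, real_smul_isPositive P.2 ht⟩ : PosOp H) ≤ D := by
      intro D d hd hd0 hD
      change (a + b + 1)⁻¹ • P.1 ≤ D.1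
      rw [le_iff_re_inner (real_smul_isPositive P.2 ht) D.2]
      intro x
      have h1 := (le_iff_re_inner P.2 (real_smul_isPositive D.2 hd0)).1 hD x
      rw [re_inner_real_smul] at h1 ⊢
      rw [inv_mul_le_iff₀ (by positivity)]
      refine h1.trans (mul_le_mul_of_nonneg_right hd ?_)
      rw [← norm_opSqrt_sq D.2]
      positivity
    have h0 := h _ (hsmul A a (by linarith) ha hA) (hsmul B b (by linarith) hb hB)
    have hP : P.1 = 0 := by
      have : (a + b + 1)⁻¹ ≠ 0 := by positivity
      exact (smul_eq_zero.1 h0).resolve_left this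
    have := rootRange_eq_bot_iff.2 hP
    rw [rootRange_projOp, Submodule.span_singleton_eq_bot] at this
    exact hy this
  · intro h C hA hB
    have hle : ∀ D : PosOp H, C ≤ D → rootRange C ≤ rootRange D := fun D hD =>
      dominated_iff_rootRange_le.1 ⟨1, zero_le_one, by simpa using hD⟩
    exact rootRange_eq_bot_iff.1 (le_bot_iff.1 (h (hle A hA) (hle B hB)))

end RootRange

/-! ### Absolute continuity as closability of forms. -/

section Closable

variable {H : Type*} [NormedAddCommGroup H] [InnerProductSpace ℂ H] [CompleteSpace H]

/-- The quadratic form of `A` is closable with respect to the quadratic form of `B`. -/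
def FormClosable (A B : PosOp H) : Prop :=
  ∀ x : ℕ → H, Tendsto (fun n => opSqrt B.1 (x n)) atTop (𝓝 0) →
    CauchySeq (fun n => opSqrt A.1 (x n)) → Tendsto (fun n => opSqrt A.1 (x n)) atTop (𝓝 0)

theorem tendsto_norm_opSqrt {C : ℕ → PosOp H} {A : PosOp H} {x : H}
    (h : Tendsto (fun n => (C n).1 x) atTop (𝓝 (A.1 x))) :
    Tendsto (fun n => ‖opSqrt (C n).1 x‖) atTop (𝓝 ‖opSqrt A.1 x‖) := by
  have h1 : Tendsto (fun n => √((⟪(C n).1 x, x⟫_ℂ).re)) atTop (𝓝 (√((⟪A.1 x, x⟫_ℂ).re))) :=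
    (Real.continuous_sqrt.tendsto _).comp
      ((Complex.continuous_re.tendsto _).comp (h.inner tendsto_const_nhds))
  simpa only [← norm_opSqrt_sq (C _).2, ← norm_opSqrt_sq A.2, Real.sqrt_sq (norm_nonneg _)]
    using h1

theorem le_of_monotone_of_tendsto {C : ℕ → PosOp H} {A : PosOp H} (hC : Monotone C)
    (h : ∀ x, Tendsto (fun n => (C n).1 x) atTop (𝓝 (A.1 x))) (n : ℕ) : C n ≤ A := by
  rw [posOp_le_iff]
  intro x
  refine Monotone.ge_of_tendsto (fun i j hij => ?_) (tendsto_norm_opSqrt (h x)) n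
  exact (posOp_le_iff _ _).1 (hC hij) x

/-- For fixed k, ‖√C_k x_n‖ ≤ ‖√A(x_n − x_m)‖ + c_k‖√B x_m‖. Letting m → ∞ leaves a bound ε/2 free
of k, and then k → ∞. -/
theorem AbsCont.formClosable {A B : PosOp H} (h : AbsCont A B) : FormClosable A B := by
  obtain ⟨C, hmono, hdom, hlim⟩ := h
  intro x hB hA
  rw [Metric.tendsto_atTop]
  intro ε hε
  obtain ⟨N, hN⟩ := Metric.cauchySeq_iff.1 hA (ε / 2) (by positivity)
  refine ⟨N, fun n hn => ?_⟩
  rw [dist_zero_right]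
  refine lt_of_le_of_lt ?_ (half_lt_self hε)
  refine le_of_tendsto (tendsto_norm_opSqrt (hlim (x n))) (Eventually.of_forall fun k => ?_)
  obtain ⟨c, hc, hcB⟩ := (dominated_iff_norm_le _ _).1 (hdom k)
  have hzero : Tendsto (fun m => ε / 2 + c * ‖opSqrt B.1 (x m)‖) atTop (𝓝 (ε / 2)) := by
    simpa using (hB.norm.const_mul c).const_add (ε / 2)
  refine ge_of_tendsto hzero ((eventually_ge_atTop N).mono fun m hm => ?_)
  calc ‖opSqrt (C k).1 (x n)‖
      = ‖opSqrt (C k).1 (x n - x m) + opSqrt (C k).1 (x m)‖ := by rw [← map_add, sub_add_cancel]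
    _ ≤ ‖opSqrt (C k).1 (x n - x m)‖ + ‖opSqrt (C k).1 (x m)‖ := norm_add_le _ _
    _ ≤ ‖opSqrt A.1 (x n - x m)‖ + c * ‖opSqrt B.1 (x m)‖ :=
        add_le_add ((posOp_le_iff _ _).1 (le_of_monotone_of_tendsto hmono hlim k) _) (hcB _)
    _ ≤ ε / 2 + c * ‖opSqrt B.1 (x m)‖ := by
        have := (hN n hn m hm).le
        rw [dist_eq_norm, ← map_sub] at this
        gcongr

/-- The powers of a positive contraction without nonzero fixed vectors tend strongly to zero. -/
theorem tendsto_pow_apply_zero {X : H →L[ℂ] H} (h0 : 0 ≤ X) (h1 : X ≤ 1)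
    (hfix : ∀ z, X z = z → z = 0) (v : H) :
    Tendsto (fun n : ℕ => (X ^ n) v) atTop (𝓝 0) := by
  have hpos : ∀ n : ℕ, (X ^ n).IsPositive := fun n =>
    (ContinuousLinearMap.nonneg_iff_isPositive _).1 (CStarAlgebra.pow_nonneg h0 n)
  set a : ℕ → ℝ := fun n => (⟪(X ^ n) v, v⟫_ℂ).re
  have hanti : Antitone a := fun m n hmn =>
    (le_iff_re_inner (hpos n) (hpos m)).1 (CStarAlgebra.pow_antitone h0 h1 hmn) v
  have ha0 : ∀ n, 0 ≤ a n := fun n => (hpos n).re_inner_nonneg_left v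
  obtain ⟨l, hl⟩ : ∃ l, Tendsto a atTop (𝓝 l) :=
    ⟨_, tendsto_atTop_ciInf hanti ⟨0, by rintro _ ⟨n, rfl⟩; exact ha0 n⟩⟩
  have hla : ∀ n, l ≤ a n := fun n => hanti.le_of_tendsto hl n
  -- Inner products along the orbit depend only on m + n, so convergence of `a` makes the orbit
  -- Cauchy. Its limit is fixed by X.
  have hinner : ∀ m n : ℕ, (⟪(X ^ m) v, (X ^ n) v⟫_ℂ).re = a (m + n) := fun m n => by
    rw [← (hpos n).inner_left_eq_inner_right, ← mul_apply_eq_comp, ← pow_add,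
      add_comm]
  have hdist : ∀ m n : ℕ, ‖(X ^ m) v - (X ^ n) v‖ ^ 2 = a (m + m) - 2 * a (m + n) + a (n + n) := by
    intro m n
    have := @norm_sub_sq ℂ H _ _ _ ((X ^ m) v) ((X ^ n) v)
    rw [this, ← @inner_self_eq_norm_sq ℂ H _ _ _ ((X ^ m) v),
      ← @inner_self_eq_norm_sq ℂ H _ _ _ ((X ^ n) v)]
    simp only [RCLike.re_to_complex, hinner]
  have hcauchy : CauchySeq fun n : ℕ => (X ^ n) v := by
    rw [Metric.cauchySeq_iff]
    intro ε hε
    obtain ⟨N, hN⟩ := (hl.eventually_lt_const (show l < l + ε ^ 2 / 2 by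
      have : 0 < ε ^ 2 / 2 := by positivity
      linarith)).exists
    refine ⟨N, fun m hm n hn => ?_⟩
    rw [dist_eq_norm]
    refine lt_of_pow_lt_pow_left₀ 2 hε.le ?_
    rw [hdist]
    have h2 := hanti (show N ≤ m + m by omega)
    have h3 := hanti (show N ≤ n + n by omega)
    have h4 := hla (m + n)
    linarith
  obtain ⟨z, hz⟩ := cauchySeq_tendsto_of_complete hcauchy
  have hXz : X z = z := by
    have h2 : Tendsto (fun n : ℕ => (X ^ (n + 1)) v) atTop (𝓝 (X z)) := by
      simpa only [pow_succ', mul_apply_eq_comp, Function.comp_def] using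
        (X.continuous.tendsto z).comp hz
    exact tendsto_nhds_unique h2 (hz.comp (tendsto_add_atTop_nat 1))
  rwa [hfix z hXz] at hz

/-- Bernoulli's inequality for operators: the term dropped in the induction is a product of
commuting positive operators. -/
theorem one_sub_pow_le {X : H →L[ℂ] H} (h0 : 0 ≤ X) (h1 : X ≤ 1) (n : ℕ) :
    1 - X ^ n ≤ (n : ℝ) • (1 - X) := by
  induction n with
  | zero => simp
  | succ n ih =>
    have h2 : 0 ≤ (1 - X ^ n) * (1 - X) := by
      refine Commute.mul_nonneg ?_ (sub_nonneg.2 h1) ?_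
      · simpa using CStarAlgebra.pow_antitone h0 h1 (Nat.zero_le n)
      · exact ((Commute.one_left _).sub_left
          ((Commute.one_right _).sub_right ((Commute.refl X).pow_left n)))
    have h3 : 1 - X ^ (n + 1) = (1 - X ^ n) + ((1 - X) - (1 - X ^ n) * (1 - X)) := by
      rw [pow_succ]
      noncomm_ring
    rw [h3, Nat.cast_succ, add_smul, one_smul]
    exact add_le_add ih (sub_le_self _ h2)

/-- If the form of `A` is closable relative to `B`, there is an injective positive contraction `D`
with `√A D √A ≤ B`. -/
theorem FormClosable.exists_contraction {A B : PosOp H} (h : FormClosable A B) :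
    ∃ D : H →L[ℂ] H, 0 ≤ D ∧ D ≤ 1 ∧ (∀ v, D v = 0 → v = 0) ∧
      ∀ x, (⟪D (opSqrt A.1 x), opSqrt A.1 x⟫_ℂ).re ≤ (⟪B.1 x, x⟫_ℂ).re := by
  -- D compresses the projection P onto (ran J)^⊥ to the second summand, where Jx = (√B x, √A x).
  -- Closability says that (0, v) lies in the closure of ran J only for v = 0, so D is injective.
  -- From PJ = 0, ‖P(0, √A x)‖ = ‖P(√B x, 0)‖ ≤ ‖√B x‖.
  let e := (WithLp.prodContinuousLinearEquiv 2 ℂ H H).symm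
  let J : H →L[ℂ] WithLp 2 (H × H) := e.toContinuousLinearMap ∘L ((opSqrt B.1).prod (opSqrt A.1))
  let ι : H →L[ℂ] WithLp 2 (H × H) := e.toContinuousLinearMap ∘L (ContinuousLinearMap.inr ℂ H H)
  let κ : H →L[ℂ] WithLp 2 (H × H) := e.toContinuousLinearMap ∘L (ContinuousLinearMap.inl ℂ H H)
  have hι : ∀ x, ‖ι x‖ = ‖x‖ := fun x => WithLp.norm_toLp_snd 2 H H x
  have hκ : ∀ x, ‖κ x‖ = ‖x‖ := fun x => WithLp.norm_toLp_fst 2 H H x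
  have hJ : ∀ x, J x = κ (opSqrt B.1 x) + ι (opSqrt A.1 x) := fun x => by
    simp only [J, ι, κ, ContinuousLinearMap.comp_apply, ← map_add]
    simp
  let K : Submodule ℂ (WithLp 2 (H × H)) := J.rangeᗮ
  have : CompleteSpace K := J.range.isClosed_orthogonal.completeSpace_coe
  have : K.HasOrthogonalProjection := .ofCompleteSpace K
  let P := K.starProjection
  let D : H →L[ℂ] H := ContinuousLinearMap.adjoint ι ∘L P ∘L ι
  have hPpos : P.IsPositive :=
    ContinuousLinearMap.IsPositive.of_isStarProjection isStarProjection_starProjection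
  have hD : D.IsPositive := hPpos.adjoint_conj ι
  have hDinner : ∀ x, (⟪D x, x⟫_ℂ).re = ‖P (ι x)‖ ^ 2 := fun x => by
    simp only [D, ContinuousLinearMap.comp_apply, ContinuousLinearMap.adjoint_inner_left]
    exact K.re_inner_starProjection_eq_normSq (ι x)
  have hPle : ∀ x, ‖P x‖ ≤ ‖x‖ := fun x => K.norm_starProjection_apply_le x
  refine ⟨D, (ContinuousLinearMap.nonneg_iff_isPositive _).2 hD, ?_, ?_, ?_⟩
  · rw [le_iff_re_inner hD ContinuousLinearMap.isPositive_one]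
    intro x
    rw [hDinner, one_apply_eq_self, ← RCLike.re_to_complex, inner_self_eq_norm_sq]
    exact pow_le_pow_left₀ (norm_nonneg _) ((hPle _).trans_eq (hι x)) 2
  · intro v hv
    have h1 := hDinner v
    rw [hv, inner_zero_left, Complex.zero_re, eq_comm, sq_eq_zero_iff, norm_eq_zero,
      Submodule.starProjection_apply_eq_zero_iff, Submodule.orthogonal_orthogonal_eq_closure]
      at h1
    obtain ⟨w, hw, hlim⟩ := mem_closure_iff_seq_limit.1 h1
    choose x hx using hw
    have hlim' : Tendsto (fun n => J (x n)) atTop (𝓝 (ι v)) := by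
      rwa [show w = fun n => J (x n) from funext fun n => (hx n).symm] at hlim
    have h2 : Tendsto (fun n => (opSqrt B.1 (x n), opSqrt A.1 (x n))) atTop (𝓝 (0, v)) :=
      (e.symm.continuous.tendsto _).comp hlim'
    have hB := (continuous_fst.tendsto _).comp h2
    have hA := (continuous_snd.tendsto _).comp h2
    exact tendsto_nhds_unique hA (h x hB hA.cauchySeq)
  · intro x
    rw [hDinner, ← norm_opSqrt_sq B.2]
    have h1 : P (J x) = 0 := by
      rw [Submodule.starProjection_apply_eq_zero_iff]
      exact Submodule.le_orthogonal_orthogonal _ ⟨x, rfl⟩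
    rw [hJ, map_add, add_comm, add_eq_zero_iff_eq_neg] at h1
    rw [h1, norm_neg]
    exact pow_le_pow_left₀ (norm_nonneg _) ((hPle _).trans_eq (hκ _)) 2

/-- The approximants are √A(1 − (1 − D)^n)√A. They are at most n√A D√A ≤ nB by Bernoulli, and they
converge because injectivity of D sends (1 − D)^n strongly to 0. -/
theorem FormClosable.absCont {A B : PosOp H} (h : FormClosable A B) : AbsCont A B := by
  obtain ⟨D, hD0, hD1, hker, hle⟩ := h.exists_contraction
  set S := opSqrt A.1
  have hX0 : 0 ≤ 1 - D := sub_nonneg.2 hD1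
  have hX1 : 1 - D ≤ 1 := sub_le_self _ hD0
  let E : ℕ → H →L[ℂ] H := fun n => 1 - (1 - D) ^ n
  have hE0 : ∀ n, (E n).IsPositive := fun n => by
    rw [← ContinuousLinearMap.nonneg_iff_isPositive, sub_nonneg]
    simpa using CStarAlgebra.pow_antitone hX0 hX1 (Nat.zero_le n)
  have hS : S.IsPositive := opSqrt_isPositive A.1
  have hSE : ∀ n, (S ∘L E n ∘L S).IsPositive := fun n => by
    simpa [hS.isSelfAdjoint.adjoint_eq] using (hE0 n).conj_adjoint S
  have hinner : ∀ n x, (⟪(S ∘L E n ∘L S) x, x⟫_ℂ).re = (⟪E n (S x), S x⟫_ℂ).re := fun n x => by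
    rw [ContinuousLinearMap.comp_apply, inner_opSqrt_left, ContinuousLinearMap.comp_apply]
  refine ⟨fun n => ⟨S ∘L E n ∘L S, hSE n⟩, fun m n hmn => ?_, fun n => ⟨n, Nat.cast_nonneg n, ?_⟩,
    fun x => ?_⟩
  · change S ∘L E m ∘L S ≤ S ∘L E n ∘L S
    rw [le_iff_re_inner (hSE m) (hSE n)]
    intro x
    rw [hinner, hinner]
    exact (le_iff_re_inner (hE0 m) (hE0 n)).1
      (sub_le_sub_left (CStarAlgebra.pow_antitone hX0 hX1 hmn) _) _
  · change S ∘L E n ∘L S ≤ _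
    rw [le_iff_re_inner (hSE n) (real_smul_isPositive B.2 (Nat.cast_nonneg n))]
    intro x
    have h1 : E n ≤ (n : ℝ) • D := by
      simpa only [sub_sub_cancel] using one_sub_pow_le hX0 hX1 n
    have hDpos := (ContinuousLinearMap.nonneg_iff_isPositive _).1 hD0
    rw [hinner, re_inner_real_smul]
    refine ((le_iff_re_inner (hE0 n) (real_smul_isPositive hDpos (Nat.cast_nonneg n))).1 h1
      (S x)).trans ?_
    rw [re_inner_real_smul]
    exact mul_le_mul_of_nonneg_left (hle x) (Nat.cast_nonneg n)
  · have h1 := tendsto_pow_apply_zero hX0 hX1 (fun z hz => hker z (by simpa using hz)) (S x)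
    have h2 : Tendsto (fun n => S (E n (S x))) atTop (𝓝 (S (S x - 0))) := by
      refine (S.continuous.tendsto _).comp ?_
      simpa [E] using h1.const_sub (S x)
    rw [sub_zero, opSqrt_opSqrt A.2] at h2
    exact h2

theorem absCont_iff_formClosable {A B : PosOp H} : AbsCont A B ↔ FormClosable A B :=
  ⟨AbsCont.formClosable, FormClosable.absCont⟩

end Closable

/-! ### The fundamental theorem of projective geometry. -/

section ProjectiveGeometry

open Submodule

variable {K L V W : Type*} [Field K] [Field L] [AddCommGroup V] [Module K V] [AddCommGroup W]
  [Module L W]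

theorem eq_and_eq_of_smul_add_eq {f : W} {S : Submodule L W} (hf : f ∉ S) {a b : L} {s t : W}
    (hs : s ∈ S) (ht : t ∈ S) (h : a • f + s = b • f + t) : a = b ∧ s = t := by
  have hab : a = b := by
    by_contra hab
    have h1 : (a - b) • f = t - s := by
      rw [sub_smul, sub_eq_sub_iff_add_eq_add, h, add_comm]
    refine hf ?_
    rw [← inv_smul_smul₀ (sub_ne_zero.2 hab) f, h1]
    exact S.smul_mem _ (S.sub_mem ht hs)
  subst hab
  exact ⟨rfl, add_left_cancel h⟩

theorem exists_mem_ker_notMem_span_singleton {e : V} {f : V →ₗ[K] K} (he : f e = 1) (hV : ∀ x y : V, ∃ z, z ∉ span K {x, y})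
    (x : V) : ∃ z, f z = 0 ∧ z ∉ span K {x} := by
  obtain ⟨z, hz⟩ := hV e x
  refine ⟨z - f z • e, by simp [he], fun h => hz ?_⟩
  obtain ⟨a, ha⟩ := mem_span_singleton.1 h
  exact mem_span_pair.2 ⟨f z, a, by rw [ha]; abel⟩

/-- A map on representatives of points that respects and reflects collinearity and is onto on
points. -/
structure IsCollineation (K L : Type*) {V W : Type*} [Field K] [Field L] [AddCommGroup V]
    [Module K V] [AddCommGroup W] [Module L W] (u : V → W) : Prop where
  mem_span_iff : ∀ x y z, u z ∈ span L {u x, u y} ↔ z ∈ span K {x, y}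
  exists_span_eq : ∀ w, ∃ x, span L {u x} = span L {w}

namespace IsCollineation

variable {u : V → W}

theorem mem_span_singleton_iff (hu : IsCollineation K L u) {x z : V} : u z ∈ span L {u x} ↔ z ∈ span K {x} := by
  simpa using hu.mem_span_iff x x z

theorem map_zero (hu : IsCollineation K L u) : u 0 = 0 := by
  obtain ⟨x, hx⟩ := hu.exists_span_eq 0
  rw [span_zero_singleton, span_singleton_eq_bot] at hx
  have : u x ∈ span L {u 0} := by simp [hx]
  rw [hu.mem_span_singleton_iff, span_zero_singleton, Submodule.mem_bot] at this
  rwa [this] at hx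

theorem eq_zero_iff (hu : IsCollineation K L u) {x : V} : u x = 0 ↔ x = 0 := by
  constructor
  · intro h
    have : u x ∈ span L {u 0} := by simp [h]
    rwa [hu.mem_span_singleton_iff, span_zero_singleton, Submodule.mem_bot] at this
  · rintro rfl
    exact hu.map_zero

/-- Normalised representatives of the points of a hyperplane `f = 0`, relative to a point `e`
off it. -/
theorem exists_normalised (hu : IsCollineation K L u) {e : V} {f : V →ₗ[K] K} (he : f e = 1) :
    ∃ t : V → W, ∀ w, f w = 0 → span L {t w} = span L {u w} ∧
      span L {u e + t w} = span L {u (e + w)} := by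
  have h : ∀ w, ∃ s : W, f w = 0 → span L {s} = span L {u w} ∧
      span L {u e + s} = span L {u (e + w)} := by
    intro w
    by_cases hw : f w = 0
    swap
    · exact ⟨0, fun h => absurd h hw⟩
    by_cases hw0 : w = 0
    · exact ⟨0, fun _ => by simp [hw0, hu.map_zero]⟩
    have h1 : u (e + w) ∈ span L {u e, u w} := by
      rw [hu.mem_span_iff, mem_span_pair]
      exact ⟨1, 1, by simp⟩
    obtain ⟨a, b, hab⟩ := mem_span_pair.1 h1
    have ha : a ≠ 0 := by
      rintro rfl
      have : u (e + w) ∈ span L {u w} := mem_span_singleton.2 ⟨b, by simpa using hab⟩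
      obtain ⟨c, hc⟩ := mem_span_singleton.1 (hu.mem_span_singleton_iff.1 this)
      simpa [hw, he] using congrArg f hc
    have hb : b ≠ 0 := by
      rintro rfl
      have : u (e + w) ∈ span L {u e} := mem_span_singleton.2 ⟨a, by simpa using hab⟩
      obtain ⟨c, hc⟩ := mem_span_singleton.1 (hu.mem_span_singleton_iff.1 this)
      have hc1 : c = 1 := by simpa [hw, he] using congrArg f hc
      rw [hc1, one_smul] at hc
      exact hw0 (by simpa using hc)
    -- The multiple of `u w` that puts `u e + t w` on the line of `u (e + w)`.
    refine ⟨(a⁻¹ * b) • u w, fun _ => ⟨?_, ?_⟩⟩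
    · exact span_singleton_smul_eq (IsUnit.mk0 _ (mul_ne_zero (inv_ne_zero ha) hb)) _
    · have : u e + (a⁻¹ * b) • u w = a⁻¹ • u (e + w) := by
        rw [← hab, smul_add, smul_smul, smul_smul, inv_mul_cancel₀ ha, one_smul]
      rw [this]
      exact span_singleton_smul_eq (IsUnit.mk0 _ (inv_ne_zero ha)) _
  choose t ht using h
  exact ⟨t, ht⟩

variable {e : V} {f : V →ₗ[K] K} {t : V → W}

theorem notMem_span_pair (hu : IsCollineation K L u) (he : f e = 1) {x y : V} (hx : f x = 0) (hy : f y = 0) :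
    u e ∉ span L {u x, u y} := by
  rw [hu.mem_span_iff, mem_span_pair]
  rintro ⟨a, b, h⟩
  simpa [hx, hy, he] using congrArg f h

theorem normalised_eq_zero_iff (hu : IsCollineation K L u)
    (ht : ∀ w, f w = 0 → span L {t w} = span L {u w} ∧ span L {u e + t w} = span L {u (e + w)})
    {w : V} (hw : f w = 0) : t w = 0 ↔ w = 0 := by
  rw [← hu.eq_zero_iff, ← span_singleton_eq_bot (R := L), (ht w hw).1, span_singleton_eq_bot]

theorem normalised_mem_span_iff (hu : IsCollineation K L u)
    (ht : ∀ w, f w = 0 → span L {t w} = span L {u w} ∧ span L {u e + t w} = span L {u (e + w)})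
    {x y : V} (hx : f x = 0) (hy : f y = 0) : t y ∈ span L {t x} ↔ y ∈ span K {x} := by
  rw [← hu.mem_span_singleton_iff, ← span_singleton_le_iff_mem, ← span_singleton_le_iff_mem,
    (ht x hx).1, (ht y hy).1]

/-- Parallelogram construction: `u (e + x + y)` lies in span(u e + t x, t y) and in span(u e + t y,
t x). Comparing coefficients makes it a multiple of u e + t x + t y, and the normalisation of `t (x
+ y)` fixes the factor. -/
theorem normalised_add_of_notMem (hu : IsCollineation K L u) (he : f e = 1)
    (ht : ∀ w, f w = 0 → span L {t w} = span L {u w} ∧ span L {u e + t w} = span L {u (e + w)})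
    {x y : V} (hx : f x = 0) (hy : f y = 0) (hxy : x ∉ span K {y}) :
    t (x + y) = t x + t y := by
  have hxy0 : f (x + y) = 0 := by simp [hx, hy]
  have hS : span L {u x, u y} = span L {t x, t y} := by
    rw [span_insert, span_insert, (ht x hx).1, (ht y hy).1]
  have hf : u e ∉ span L {t x, t y} := hS ▸ hu.notMem_span_pair he hx hy
  have htx : t x ∈ span L {t x, t y} := subset_span (by simp)
  have hty : t y ∈ span L {t x, t y} := subset_span (by simp)
  have htxy : t (x + y) ∈ span L {t x, t y} := by
    have : u (x + y) ∈ span L {u x, u y} := by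
      rw [hu.mem_span_iff, mem_span_pair]
      exact ⟨1, 1, by simp⟩
    rw [← hS]
    rw [← span_singleton_le_iff_mem] at this ⊢
    rwa [(ht _ hxy0).1]
  have key : ∀ {x y : V}, f x = 0 → f y = 0 → u (e + (x + y)) ∈ span L {u e + t x, t y} := by
    intro x y hx hy
    rw [span_insert, (ht x hx).2, (ht y hy).1, ← span_insert, hu.mem_span_iff, mem_span_pair]
    exact ⟨1, 1, by simp [add_assoc]⟩
  obtain ⟨a, b, hab⟩ := mem_span_pair.1 (key hx hy)
  obtain ⟨a', b', hab'⟩ := mem_span_pair.1 (add_comm y x ▸ key hy hx)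
  rw [smul_add, add_assoc] at hab hab'
  obtain ⟨rfl, h2⟩ := eq_and_eq_of_smul_add_eq hf
    (add_mem (smul_mem _ _ htx) (smul_mem _ _ hty))
    (add_mem (smul_mem _ _ hty) (smul_mem _ _ htx)) (hab.trans hab'.symm)
  have hxy' : t x ∉ span L {t y} := by rwa [hu.normalised_mem_span_iff ht hy hx]
  obtain ⟨-, h3⟩ := eq_and_eq_of_smul_add_eq hxy' (smul_mem _ b (mem_span_singleton_self _))
    (smul_mem _ a (mem_span_singleton_self _)) (h2.trans (add_comm _ _))
  have h4 : u e + t (x + y) ∈ span L {u (e + (x + y))} :=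
    (ht _ hxy0).2 ▸ mem_span_singleton_self _
  obtain ⟨k, hk⟩ := mem_span_singleton.1 h4
  rw [← hab, h3, smul_add, smul_smul] at hk
  obtain ⟨h5, h6⟩ := eq_and_eq_of_smul_add_eq (a := k * a) (b := 1) hf
    (smul_mem _ k (add_mem (smul_mem _ a htx) (smul_mem _ a hty))) htxy (hk.trans (by rw [one_smul]))
  rw [← h6, ← smul_add, smul_smul, h5, one_smul]

theorem normalised_smul_add (hu : IsCollineation K L u) (he : f e = 1)
    (ht : ∀ w, f w = 0 → span L {t w} = span L {u w} ∧ span L {u e + t w} = span L {u (e + w)})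
    {x z : V} (hx : f x = 0) (hz : f z = 0) (hzx : z ∉ span K {x}) (a : K) :
    t (a • x + z) = t (a • x) + t z := by
  by_cases ha : a • x = 0
  · rw [ha, zero_add, (hu.normalised_eq_zero_iff ht (by simp)).2 rfl, zero_add]
  · obtain ⟨ha0, hx0⟩ := smul_ne_zero_iff.1 ha
    have hspan : span K {a • x} = span K {x} := span_singleton_smul_eq (IsUnit.mk0 _ ha0) _
    refine hu.normalised_add_of_notMem he ht (by simp [hx]) hz ?_
    intro h
    obtain ⟨b, hb⟩ := mem_span_singleton.1 h
    have hb0 : b ≠ 0 := by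
      rintro rfl
      exact ha (by simpa using hb.symm)
    refine hzx ?_
    rw [← hspan, ← inv_smul_smul₀ hb0 z, hb]
    exact smul_mem _ _ (mem_span_singleton_self _)

/-- Collinear summands x and cx are handled by a vector z of the hyperplane off their line: t(x + cx
+ z) is expanded in two ways. -/
theorem normalised_add (hu : IsCollineation K L u) (he : f e = 1) (hV : ∀ x y : V, ∃ z, z ∉ span K {x, y})
    (ht : ∀ w, f w = 0 → span L {t w} = span L {u w} ∧ span L {u e + t w} = span L {u (e + w)})
    {x y : V} (hx : f x = 0) (hy : f y = 0) : t (x + y) = t x + t y := by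
  have key : ∀ (x : V) (c : K), f x = 0 → t (x + c • x) = t x + t (c • x) := by
    intro x c hx
    obtain ⟨z, hz, hzx⟩ := exists_mem_ker_notMem_span_singleton he hV x
    have hzc : c • x + z ∉ span K {x} := fun h =>
      hzx ((Submodule.add_mem_iff_right _ (smul_mem _ c (mem_span_singleton_self x))).1 h)
    have h1 := hu.normalised_smul_add he ht hx hz hzx (1 + c)
    have h2 := hu.normalised_smul_add he ht hx (by simp [hx, hz]) hzc 1
    have h3 := hu.normalised_smul_add he ht hx hz hzx c
    rw [one_smul, h3] at h2
    rw [add_smul, one_smul, add_assoc, h2, ← add_assoc] at h1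
    exact (add_right_cancel h1).symm
  by_cases hxy : x ∈ span K {y}
  · obtain ⟨c, rfl⟩ := mem_span_singleton.1 hxy
    rw [add_comm, key y c hy, add_comm]
  exact hu.normalised_add_of_notMem he ht hx hy hxy

/-- Additivity at x + y shows that independent x and y have the same scaling factor; collinear
vectors are compared through a third one off their line. -/
theorem exists_normalised_smul (hu : IsCollineation K L u) (he : f e = 1) (hV : ∀ x y : V, ∃ z, z ∉ span K {x, y})
    (ht : ∀ w, f w = 0 → span L {t w} = span L {u w} ∧ span L {u e + t w} = span L {u (e + w)}) :
    ∃ σ : K →+* L, ∀ (c : K) (x : V), f x = 0 → t (c • x) = σ c • t x := by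
  have hs : ∀ (x : V) (c : K), ∃ s : L, f x = 0 → t (c • x) = s • t x := by
    intro x c
    by_cases hx : f x = 0
    swap
    · exact ⟨0, fun h => absurd h hx⟩
    have : t (c • x) ∈ span L {t x} := by
      rw [hu.normalised_mem_span_iff ht hx (by simp [hx])]
      exact smul_mem _ _ (mem_span_singleton_self _)
    obtain ⟨s, hs⟩ := mem_span_singleton.1 this
    exact ⟨s, fun _ => hs.symm⟩
  choose s hs using hs
  have hindep : ∀ (x y : V) (c : K), f x = 0 → f y = 0 → x ≠ 0 → y ∉ span K {x} →
      s x c = s y c := by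
    intro x y c hx hy hx0 hyx
    have h1 := hs (x + y) c (by simp [hx, hy])
    rw [smul_add, hu.normalised_add he hV ht (by simp [hx]) (by simp [hy]),
      hu.normalised_add he hV ht hx hy, hs x c hx, hs y c hy, smul_add, add_comm,
      add_comm (s (x + y) c • t x)] at h1
    obtain ⟨h2, h3⟩ := eq_and_eq_of_smul_add_eq
      (mt (hu.normalised_mem_span_iff ht hx hy).1 hyx)
      (smul_mem _ _ (mem_span_singleton_self _)) (smul_mem _ _ (mem_span_singleton_self _)) h1
    rw [h2]
    exact smul_left_injective L (mt (hu.normalised_eq_zero_iff ht hx).1 hx0) h3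
  obtain ⟨x₀, hx₀, hx₀'⟩ := exists_mem_ker_notMem_span_singleton he hV 0
  have hx₀0 : x₀ ≠ 0 := by simpa using hx₀'
  have htx₀ : t x₀ ≠ 0 := mt (hu.normalised_eq_zero_iff ht hx₀).1 hx₀0
  have hall : ∀ (c : K) (x : V), f x = 0 → t (c • x) = s x₀ c • t x := by
    intro c x hx
    by_cases hx0 : x = 0
    · rw [hx0, smul_zero, (hu.normalised_eq_zero_iff ht (by simp)).2 rfl, smul_zero]
    rw [hs x c hx]
    by_cases hxx : x ∈ span K {x₀}
    · obtain ⟨z, hz, hzx⟩ := exists_mem_ker_notMem_span_singleton he hV x₀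
      have hzx' : z ∉ span K {x} := fun h =>
        hzx ((span_singleton_le_iff_mem _ _).2 hxx h)
      rw [hindep x z c hx hz hx0 hzx', hindep x₀ z c hx₀ hz hx₀0 hzx]
    · rw [hindep x₀ x c hx₀ hx hx₀0 hxx]
  have hinj := smul_left_injective L htx₀
  refine ⟨⟨⟨⟨s x₀, ?_⟩, ?_⟩, ?_, ?_⟩, hall⟩
  · refine hinj ?_
    change s x₀ 1 • t x₀ = (1 : L) • t x₀
    rw [← hall 1 x₀ hx₀, one_smul, one_smul]
  · intro a b
    refine hinj ?_
    change s x₀ (a * b) • t x₀ = (s x₀ a * s x₀ b) • t x₀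
    rw [← hall _ x₀ hx₀, mul_smul, hall _ _ (by simp [hx₀]), hall _ _ hx₀, mul_smul]
  · refine hinj ?_
    change s x₀ 0 • t x₀ = (0 : L) • t x₀
    rw [← hall _ x₀ hx₀, zero_smul, zero_smul, (hu.normalised_eq_zero_iff ht (by simp)).2 rfl]
  · intro a b
    refine hinj ?_
    change s x₀ (a + b) • t x₀ = (s x₀ a + s x₀ b) • t x₀
    rw [← hall _ x₀ hx₀, add_smul, hu.normalised_add he hV ht (by simp [hx₀]) (by simp [hx₀]),
      hall _ _ hx₀, hall _ _ hx₀, add_smul]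

/-- The fundamental theorem of projective geometry: in dimension at least three, a collineation is
induced by a semilinear bijection. -/
theorem exists_semilinear (hu : IsCollineation K L u) (hV : ∀ x y : V, ∃ z, z ∉ span K {x, y}) :
    ∃ (σ : K ≃+* L) (T : V ≃+ W), (∀ (c : K) (x : V), T (c • x) = σ c • T x) ∧
      ∀ x, span L {T x} = span L {u x} := by
  obtain ⟨e, he0⟩ := hV 0 0
  have he0 : e ≠ 0 := by simpa using he0
  obtain ⟨f, he⟩ : ∃ f : V →ₗ[K] K, f e = 1 :=
    Module.Projective.exists_dual_eq_one K he0
  obtain ⟨t, ht⟩ := hu.exists_normalised he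
  obtain ⟨σ, hσ⟩ := hu.exists_normalised_smul he hV ht
  have hq : ∀ v, f (v - f v • e) = 0 := fun v => by simp [he]
  -- Extension of `t` from the hyperplane along v = f(v)e + (v − f(v)e).
  let T : V →+ W :=
    { toFun := fun v => σ (f v) • u e + t (v - f v • e)
      map_zero' := by simp [(hu.normalised_eq_zero_iff ht (f := f) (w := 0) (by simp)).2]
      map_add' := fun v w => by
        have : v + w - f (v + w) • e = (v - f v • e) + (w - f w • e) := by
          rw [map_add, add_smul]
          abel
        simp only [this]
        rw [hu.normalised_add he hV ht (hq v) (hq w), map_add, map_add, add_smul]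
        abel }
  have hT : ∀ v, T v = σ (f v) • u e + t (v - f v • e) := fun _ => rfl
  have hsmul : ∀ (c : K) (x : V), T (c • x) = σ c • T x := by
    intro c x
    have : c • x - f (c • x) • e = c • (x - f x • e) := by
      rw [map_smul, smul_eq_mul, mul_smul, smul_sub]
    rw [hT, hT, this, hσ _ _ (hq x), map_smul, smul_eq_mul, map_mul, mul_smul, smul_add]
  have hspan : ∀ x, span L {T x} = span L {u x} := by
    intro x
    by_cases hx : f x = 0
    · rw [hT, hx]
      simpa using (ht x hx).1
    · set w := (f x)⁻¹ • (x - f x • e) with hw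
      have hfw : f w = 0 := by rw [hw, map_smul, hq, smul_zero]
      have hxw : x = f x • (e + w) := by
        rw [hw, smul_add, smul_inv_smul₀ hx]
        abel
      have hTw : T (e + w) = u e + t w := by
        rw [hT, map_add, he, hfw, add_zero, map_one, one_smul, one_smul, add_sub_cancel_left]
      have hux : span L {u x} = span L {u (e + w)} := by
        apply le_antisymm <;> rw [span_singleton_le_iff_mem, hu.mem_span_singleton_iff]
        · exact mem_span_singleton.2 ⟨f x, hxw.symm⟩
        · exact mem_span_singleton.2 ⟨(f x)⁻¹, by
            conv_lhs => rw [hxw]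
            rw [← hxw, inv_smul_eq_iff₀ hx, ← hxw]⟩
      have hσx : IsUnit (σ (f x)) := (IsUnit.mk0 _ hx).map σ
      conv_lhs => rw [hxw]
      rw [hsmul, span_singleton_smul_eq hσx, hTw, (ht w hfw).2, hux]
  have hTinj : Function.Injective T := by
    rw [injective_iff_map_eq_zero]
    intro x hx
    rw [← hu.eq_zero_iff, ← span_singleton_eq_bot (R := L), ← hspan, hx, span_zero_singleton]
  -- The point of Te + d·Tx comes from some ae + bx with x independent of e; then d = σ(b/a).
  have hσsurj : Function.Surjective σ := by
    intro d
    obtain ⟨x, hx⟩ := hV e e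
    rw [Set.pair_eq_singleton] at hx
    have hTx : T x ∉ span L {T e} := by
      rwa [hspan, ← span_singleton_le_iff_mem, hspan, span_singleton_le_iff_mem,
        hu.mem_span_singleton_iff]
    obtain ⟨v, hv⟩ := hu.exists_span_eq (T e + d • T x)
    have h1 : v ∈ span K {e, x} := by
      rw [← hu.mem_span_iff, ← span_singleton_le_iff_mem, hv, span_singleton_le_iff_mem,
        span_insert, ← hspan e, ← hspan x, ← span_insert]
      exact mem_span_pair.2 ⟨1, d, by rw [one_smul]⟩
    obtain ⟨a, b, rfl⟩ := mem_span_pair.1 h1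
    rw [← hspan] at hv
    have h2 : T e + d • T x ∈ span L {T (a • e + b • x)} := hv ▸ mem_span_singleton_self _
    obtain ⟨k, hk⟩ := mem_span_singleton.1 h2
    rw [map_add, hsmul, hsmul, smul_add, smul_smul, smul_smul, add_comm, add_comm (T e)] at hk
    obtain ⟨h3, h4⟩ := eq_and_eq_of_smul_add_eq hTx
      (smul_mem _ _ (mem_span_singleton_self _)) (mem_span_singleton_self _) hk
    have hTe : T e ≠ 0 := (map_ne_zero_iff T hTinj).2 he0
    have h5 : k * σ a = 1 := smul_left_injective L hTe (by simpa using h4)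
    refine ⟨b * a⁻¹, ?_⟩
    rw [map_mul, map_inv₀, ← h3, eq_inv_of_mul_eq_one_left h5]
    ring
  have hTsurj : Function.Surjective T := by
    intro w
    obtain ⟨x, hx⟩ := hu.exists_span_eq w
    have h1 : w ∈ span L {T x} := by
      rw [hspan, hx]
      exact mem_span_singleton_self _
    obtain ⟨d, hd⟩ := mem_span_singleton.1 h1
    obtain ⟨c, rfl⟩ := hσsurj d
    exact ⟨c • x, by rw [hsmul, hd]⟩
  exact ⟨RingEquiv.ofBijective σ ⟨σ.injective, hσsurj⟩,
    AddEquiv.ofBijective T ⟨hTinj, hTsurj⟩, hsmul, hspan⟩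

end IsCollineation

end ProjectiveGeometry

/-! ### Recovering inclusion of root ranges from ≪ and from ⊥. -/

section RangeOrder

variable {H : Type*} [NormedAddCommGroup H] [InnerProductSpace ℂ H] [CompleteSpace H]

theorem span_singleton_le_rootRange {A : PosOp H} {x : H} (hx : x ∈ rootRange A) :
    rootRange (projOp (ℂ ∙ x)) ≤ rootRange A := by
  rwa [rootRange_projOp, Submodule.span_singleton_le_iff_mem]

theorem Dominated.absCont {A B : PosOp H} (h : Dominated A B) : AbsCont A B :=
  ⟨fun _ => A, monotone_const, fun _ => h, fun _ => tendsto_const_nhds⟩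

theorem absCont_of_rootRange_le {A B : PosOp H} (h : rootRange A ≤ rootRange B) : AbsCont A B :=
  (dominated_iff_rootRange_le.2 h).absCont

/-- Closability along constant sequences gives ker B ⊆ ker A, hence ran √A ⊆ (ker √B)^⊥. This is ran
√B itself, as the instance makes that range equal to its double orthogonal complement. -/
theorem AbsCont.rootRange_le {A B : PosOp H} (h : AbsCont A B)
    [(rootRange B).HasOrthogonalProjection] : rootRange A ≤ rootRange B := by
  rw [← (rootRange B).orthogonal_orthogonal]
  rintro _ ⟨x, rfl⟩
  rw [Submodule.mem_orthogonal]
  intro v hv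
  have hBv : opSqrt B.1 v = 0 := by
    rw [← inner_self_eq_zero (𝕜 := ℂ), inner_opSqrt_left]
    exact (Submodule.mem_orthogonal' _ _).1 hv _ ⟨opSqrt B.1 v, rfl⟩
  have hAv : opSqrt A.1 v = 0 :=
    tendsto_nhds_unique tendsto_const_nhds
      (h.formClosable (fun _ => v) (by simp [hBv]) (cauchySeq_const _))
  change ⟪v, opSqrt A.1 x⟫_ℂ = 0
  rw [← inner_opSqrt_left, hAv, inner_zero_left]

/-- When A ≠ 0, some approximant of A is nonzero. Its root range lies in a line, so it is that line,
and the approximant is B-dominated. -/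
theorem AbsCont.rootRange_le_of_span_singleton {A B : PosOp H} (h : AbsCont A B) {x : H}
    (hA : rootRange A = ℂ ∙ x) : rootRange A ≤ rootRange B := by
  obtain ⟨C, hmono, hdom, hlim⟩ := h
  by_cases hA0 : A.1 = 0
  · rw [rootRange_eq_bot_iff.2 hA0]
    exact bot_le
  have hx : x ≠ 0 := by
    rintro rfl
    exact hA0 (rootRange_eq_bot_iff.1 (by simpa using hA))
  obtain ⟨n, hn⟩ : ∃ n, (C n).1 ≠ 0 := by
    by_contra! hC
    refine hA0 (ContinuousLinearMap.ext fun v => ?_)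
    have := hlim v
    simp only [hC] at this
    exact tendsto_nhds_unique this tendsto_const_nhds
  have hle : rootRange (C n) ≤ rootRange A := dominated_iff_rootRange_le.1
    ⟨1, zero_le_one, by simpa using le_of_monotone_of_tendsto hmono hlim n⟩
  rw [hA] at hle ⊢
  rcases (nonzero_span_atom (K := ℂ) x hx).le_iff.1 hle with h1 | h1
  · exact absurd (rootRange_eq_bot_iff.1 h1) hn
  · rw [← h1]
    exact dominated_iff_rootRange_le.1 (hdom n)

theorem eq_zero_iff_forall_absCont {A : PosOp H} : A.1 = 0 ↔ ∀ B : PosOp H, AbsCont A B := by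
  constructor
  · intro h B
    refine absCont_of_rootRange_le ?_
    rw [rootRange_eq_bot_iff.2 h]
    exact bot_le
  · intro h
    have hbot : rootRange (projOp (⊥ : Submodule ℂ H)) = ⊥ := rootRange_projOp _
    have : (rootRange (projOp (⊥ : Submodule ℂ H))).HasOrthogonalProjection := by
      rw [hbot]
      infer_instance
    have := (h (projOp ⊥)).rootRange_le
    rw [hbot, le_bot_iff] at this
    exact rootRange_eq_bot_iff.1 this

/-- The positive operators of rank one, in terms of absolute continuity. -/
theorem rootRange_eq_span_singleton_iff {A : PosOp H} :
    (∃ x : H, x ≠ 0 ∧ rootRange A = ℂ ∙ x) ↔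
      A.1 ≠ 0 ∧ ∀ B : PosOp H, B.1 ≠ 0 → AbsCont B A → AbsCont A B := by
  have hproj : ∀ {C : PosOp H} {x : H}, rootRange C = ℂ ∙ x →
      (rootRange C).HasOrthogonalProjection := fun {C x} h => by
    rw [h]
    infer_instance
  constructor
  · rintro ⟨x, hx, hA⟩
    refine ⟨fun h => hx ?_, fun B hB hBA => absCont_of_rootRange_le ?_⟩
    · rwa [rootRange_eq_bot_iff.2 h, eq_comm, Submodule.span_singleton_eq_bot] at hA
    · have := hproj hA
      have hle := hBA.rootRange_le
      rw [hA] at hle ⊢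
      rcases (nonzero_span_atom (K := ℂ) x hx).le_iff.1 hle with h1 | h1
      · exact absurd (rootRange_eq_bot_iff.1 h1) hB
      · exact h1.ge
  · rintro ⟨hA, h⟩
    obtain ⟨x, hxA, hx⟩ := Submodule.exists_mem_ne_zero_of_ne_bot (mt rootRange_eq_bot_iff.1 hA)
    refine ⟨x, hx, le_antisymm ?_ (by rwa [Submodule.span_singleton_le_iff_mem])⟩
    have hP : rootRange (projOp (ℂ ∙ x)) = ℂ ∙ x := rootRange_projOp _
    have h1 := h (projOp (ℂ ∙ x))
      (fun h0 => hx (by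
        rwa [rootRange_eq_bot_iff.2 h0, eq_comm, Submodule.span_singleton_eq_bot] at hP))
      (absCont_of_rootRange_le (span_singleton_le_rootRange hxA))
    have := hproj hP
    exact h1.rootRange_le.trans hP.le

/-- Rank-one operators probe vectors: for C with root range ℂx, C ≪ B means x ∈ ran √B. -/
theorem rootRange_le_iff_forall_absCont {A B : PosOp H} :
    rootRange A ≤ rootRange B ↔
      ∀ C : PosOp H, (∃ x : H, x ≠ 0 ∧ rootRange C = ℂ ∙ x) → AbsCont C A → AbsCont C B := by
  constructor
  · rintro h C ⟨x, -, hC⟩ hCA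
    exact absCont_of_rootRange_le ((hCA.rootRange_le_of_span_singleton hC).trans h)
  · intro h x hx
    by_cases hx0 : x = 0
    · rw [hx0]
      exact zero_mem _
    have hP : rootRange (projOp (ℂ ∙ x)) = ℂ ∙ x := rootRange_projOp _
    have h1 := h _ ⟨x, hx0, hP⟩ (absCont_of_rootRange_le (span_singleton_le_rootRange hx))
    have h2 := h1.rootRange_le_of_span_singleton hP
    rwa [hP, Submodule.span_singleton_le_iff_mem] at h2

/-- If x lies in ran √A but not in ran √B, the projection onto ℂx is singular to B and not to A. -/
theorem rootRange_le_iff_forall_singular {A B : PosOp H} :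
    rootRange A ≤ rootRange B ↔ ∀ C : PosOp H, Singular C B → Singular C A := by
  simp only [singular_iff_disjoint]
  constructor
  · intro h C hC
    exact hC.mono_right h
  · intro h x hx
    by_contra hxB
    have h1 := h (projOp (ℂ ∙ x)) (by
      rw [rootRange_projOp, Submodule.disjoint_def]
      intro y hy hyB
      obtain ⟨c, rfl⟩ := Submodule.mem_span_singleton.1 hy
      by_cases hc : c = 0
      · rw [hc, zero_smul]
      · exact absurd ((Submodule.smul_mem_iff _ hc).1 hyB) hxB)
    rw [rootRange_projOp, Submodule.disjoint_def] at h1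
    have hx0 := h1 x (Submodule.mem_span_singleton_self x) hx
    exact hxB (hx0 ▸ zero_mem _)

/-- Being zero, being of rank one and inclusion are successively expressed by ≪ and quantifiers over
all operators, which a surjective φ transports. -/
theorem rootRange_le_iff_of_absCont {φ : PosOp H → PosOp H} (hφ : Function.Surjective φ)
    (h : ∀ A B : PosOp H, AbsCont A B ↔ AbsCont (φ A) (φ B)) (A B : PosOp H) :
    rootRange A ≤ rootRange B ↔ rootRange (φ A) ≤ rootRange (φ B) := by
  have hzero : ∀ A : PosOp H, A.1 = 0 ↔ (φ A).1 = 0 := fun A => by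
    rw [eq_zero_iff_forall_absCont, eq_zero_iff_forall_absCont,
      hφ.forall (p := fun B => AbsCont (φ A) B)]
    exact forall_congr' fun B => h A B
  have hline : ∀ A : PosOp H, (∃ x : H, x ≠ 0 ∧ rootRange A = ℂ ∙ x) ↔
      ∃ x : H, x ≠ 0 ∧ rootRange (φ A) = ℂ ∙ x := fun A => by
    rw [rootRange_eq_span_singleton_iff, rootRange_eq_span_singleton_iff,
      hφ.forall (p := fun B => B.1 ≠ 0 → AbsCont B (φ A) → AbsCont (φ A) B)]
    simp only [← hzero, ← h, ne_eq]
  rw [rootRange_le_iff_forall_absCont, rootRange_le_iff_forall_absCont,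
    hφ.forall (p := fun C => (∃ x : H, x ≠ 0 ∧ rootRange C = ℂ ∙ x) → AbsCont C (φ A) →
      AbsCont C (φ B))]
  simp only [← hline, ← h]

theorem rootRange_le_iff_of_singular {φ : PosOp H → PosOp H} (hφ : Function.Surjective φ)
    (h : ∀ A B : PosOp H, Singular A B ↔ Singular (φ A) (φ B)) (A B : PosOp H) :
    rootRange A ≤ rootRange B ↔ rootRange (φ A) ≤ rootRange (φ B) := by
  rw [rootRange_le_iff_forall_singular, rootRange_le_iff_forall_singular,
    hφ.forall (p := fun C => Singular C (φ B) → Singular C (φ A))]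
  simp only [← h]

theorem exists_rootRange_eq_span_singleton {φ : PosOp H → PosOp H} (hφ : Function.Surjective φ)
    (h : ∀ A B : PosOp H, rootRange A ≤ rootRange B ↔ rootRange (φ A) ≤ rootRange (φ B))
    {A : PosOp H} {x : H} (hA : rootRange A = ℂ ∙ x) : ∃ w : H, rootRange (φ A) = ℂ ∙ w := by
  by_cases hbot : rootRange (φ A) = ⊥
  · exact ⟨0, by simpa using hbot⟩
  obtain ⟨w, hwA, hw⟩ := Submodule.exists_mem_ne_zero_of_ne_bot hbot
  refine ⟨w, le_antisymm ?_ (by rwa [Submodule.span_singleton_le_iff_mem])⟩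
  obtain ⟨B, hB⟩ := hφ (projOp (ℂ ∙ w))
  have hBw : rootRange (φ B) = ℂ ∙ w := by rw [hB, rootRange_projOp]
  have hBA : rootRange B ≤ rootRange A := by
    rw [h, hB]
    exact span_singleton_le_rootRange hwA
  rw [← hBw, ← h]
  by_cases hx : x = 0
  · rw [hA, hx, Submodule.span_zero_singleton]
    exact bot_le
  rw [hA] at hBA ⊢
  rcases (nonzero_span_atom (K := ℂ) x hx).le_iff.1 hBA with h1 | h1
  -- A trivial root range for B would put B below the preimage of 0, forcing w = 0.
  · obtain ⟨Z, hZ⟩ := hφ (projOp ⊥)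
    have h2 := (h B Z).1 (h1.trans_le bot_le)
    rw [hZ, rootRange_projOp, hBw, le_bot_iff, Submodule.span_singleton_eq_bot] at h2
    exact absurd h2 hw
  · exact h1.ge

/-- A bijection that preserves inclusion of root ranges is induced by a semilinear bijection. -/
theorem exists_semilinear_of_rootRange_le_iff (hH : ¬ FiniteDimensional ℂ H)
    {φ : PosOp H → PosOp H} (hφ : Function.Bijective φ)
    (h : ∀ A B : PosOp H, rootRange A ≤ rootRange B ↔ rootRange (φ A) ≤ rootRange (φ B)) :
    ∃ (σ : ℂ ≃+* ℂ) (T : H ≃+ H), (∀ (c : ℂ) (x : H), T (c • x) = σ c • T x) ∧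
      ∀ (A : PosOp H) (x : H), T x ∈ rootRange (φ A) ↔ x ∈ rootRange A := by
  have hex : ∀ x : H, ∃ w : H, rootRange (φ (projOp (ℂ ∙ x))) = ℂ ∙ w := fun x =>
    exists_rootRange_eq_span_singleton hφ.2 h (rootRange_projOp _)
  choose u hu using hex
  have hmem : ∀ (A : PosOp H) (x : H), u x ∈ rootRange (φ A) ↔ x ∈ rootRange A := fun A x => by
    rw [← Submodule.span_singleton_le_iff_mem, ← hu, ← h, rootRange_projOp,
      Submodule.span_singleton_le_iff_mem]
  have hcol : IsCollineation ℂ ℂ u := by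
    refine ⟨fun x y z => ⟨fun hz => ?_, fun hz => ?_⟩, fun w => ?_⟩
    -- A finite-dimensional span is the root range of its projection, so `hmem` transports
    -- membership in it.
    · have := FiniteDimensional.span_of_finite ℂ (Set.toFinite {x, y})
      have hN : rootRange (projOp (Submodule.span ℂ {x, y})) = Submodule.span ℂ {x, y} :=
        rootRange_projOp _
      rw [← hN, ← hmem]
      refine Submodule.span_le.2 ?_ hz
      rintro _ (rfl | rfl)
      · exact (hmem _ _).2 (by rw [hN]; exact Submodule.subset_span (by simp))
      · exact (hmem _ _).2 (by rw [hN]; exact Submodule.subset_span (by simp))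
    · have := FiniteDimensional.span_of_finite ℂ (Set.toFinite {u x, u y})
      obtain ⟨B, hB⟩ := hφ.2 (projOp (Submodule.span ℂ {u x, u y}))
      have hBM : rootRange (φ B) = Submodule.span ℂ {u x, u y} := by rw [hB, rootRange_projOp]
      rw [← hBM, hmem]
      refine Submodule.span_le.2 ?_ hz
      rintro _ (rfl | rfl)
      · exact (hmem _ _).1 (hBM ▸ Submodule.subset_span (by simp))
      · exact (hmem _ _).1 (hBM ▸ Submodule.subset_span (by simp))
    · let ψ := Equiv.ofBijective φ hφ
      obtain ⟨x, hx⟩ := exists_rootRange_eq_span_singleton (φ := ψ.symm) ψ.symm.surjective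
        (fun A B => by
          rw [h (ψ.symm A)]
          change _ ↔ rootRange (ψ (ψ.symm A)) ≤ rootRange (ψ (ψ.symm B))
          rw [ψ.apply_symm_apply, ψ.apply_symm_apply]) (rootRange_projOp (ℂ ∙ w))
      refine ⟨x, ?_⟩
      have h1 : ∀ A B : PosOp H, rootRange A = rootRange B →
          rootRange (φ A) = rootRange (φ B) := fun A B hAB =>
        le_antisymm ((h _ _).1 hAB.le) ((h _ _).1 hAB.ge)
      rw [← hu, ← h1 (ψ.symm (projOp (ℂ ∙ w))) _ (by rw [hx, rootRange_projOp])]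
      change rootRange (ψ (ψ.symm _)) = _
      rw [ψ.apply_symm_apply, rootRange_projOp]
  have hV : ∀ x y : H, ∃ z, z ∉ Submodule.span ℂ {x, y} := by
    intro x y
    by_contra! hxy
    refine hH ⟨?_⟩
    rw [← (Submodule.eq_top_iff'.2 hxy)]
    exact Submodule.fg_span (by simp)
  obtain ⟨σ, T, hsmul, hspan⟩ := hcol.exists_semilinear hV
  refine ⟨σ, T, hsmul, fun A x => ?_⟩
  rw [← hmem A x, ← Submodule.span_singleton_le_iff_mem, hspan, Submodule.span_singleton_le_iff_mem]

end RangeOrder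

/-! ### Boundedness of the semilinear bijection. -/

section Continuity

variable {H : Type*} [NormedAddCommGroup H] [InnerProductSpace ℂ H] [CompleteSpace H]

/-- A linear functional whose kernel is the range of a bounded operator is continuous. -/
theorem continuous_of_ker_eq_range {f : H →ₗ[ℂ] ℂ} {S : H →L[ℂ] H}
    (h : ∀ x, f x = 0 ↔ x ∈ S.range) : Continuous f := by
  by_cases hf : ∃ x, f x ≠ 0
  swap
  · push Not at hf
    rw [show f = 0 from LinearMap.ext hf]
    exact continuous_const
  obtain ⟨x, hx⟩ := hf
  -- (v, c) ↦ Sv + cx is onto, hence a quotient map by the open mapping theorem, and f pulls back to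
  -- the continuous (v, c) ↦ c·f(x).
  let q : H × ℂ →L[ℂ] H := S.coprod (ContinuousLinearMap.toSpanSingleton ℂ x)
  have hfq : ∀ p : H × ℂ, f (q p) = p.2 * f x := fun p => by
    simp only [q, ContinuousLinearMap.coprod_apply, ContinuousLinearMap.toSpanSingleton_apply,
      map_add, map_smul, smul_eq_mul]
    rw [(h (S p.1)).2 ⟨p.1, rfl⟩, zero_add]
  have hq : Function.Surjective q := by
    intro y
    obtain ⟨v, hv⟩ := (h (y - (f y / f x) • x)).1 (by simp [hx])
    refine ⟨(v, f y / f x), ?_⟩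
    simp only [q, ContinuousLinearMap.coprod_apply, ContinuousLinearMap.toSpanSingleton_apply]
    exact (congrArg (· + (f y / f x) • x) hv).trans (sub_add_cancel _ _)
  rw [((q.isOpenMap hq).isQuotientMap q.continuous hq).continuous_iff]
  exact (continuous_snd.mul continuous_const).congr fun p => (hfq p).symm

theorem exists_orthonormal_nat (hH : ¬ FiniteDimensional ℂ H) :
    ∃ e : ℕ → H, Orthonormal ℂ e := by
  obtain ⟨w, b, hb⟩ := exists_hilbertBasis ℂ H
  have hw : Infinite w := by
    by_contra hfin
    have : Finite w := not_infinite_iff_finite.1 hfin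
    have : Fintype w := Fintype.ofFinite w
    exact hH (b.toOrthonormalBasis.toBasis.finiteDimensional_of_finite)
  exact ⟨_, b.orthonormal.comp (Infinite.natEmbedding w) (Infinite.natEmbedding w).injective⟩

/-- An orthonormal sequence realises every geometrically decaying coefficient sequence. -/
theorem exists_inner_eq_of_orthonormal {e : ℕ → H} (he : Orthonormal ℂ e) {a : ℕ → ℂ}
    (ha : ∀ n, ‖a n‖ ≤ (1 / 2) ^ n) : ∃ y : H, ∀ n, ⟪y, e n⟫_ℂ = a n := by
  have hsum : Summable fun n => conj (a n) • e n :=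
    Summable.of_norm_bounded summable_geometric_two fun n => by
      simpa [norm_smul, he.1 n] using ha n
  refine ⟨∑' n, conj (a n) • e n, fun n => ?_⟩
  have h1 := hsum.hasSum.mapL (innerSL ℂ (e n))
  have h2 : HasSum (fun m => innerSL ℂ (e n) (conj (a m) • e m)) (conj (a n)) := by
    have := hasSum_single (f := fun m => innerSL ℂ (e n) (conj (a m) • e m)) n fun m hm => by
      simp [he.2 hm.symm]
    simpa [inner_smul_right, inner_self_eq_norm_sq_to_K, he.1 n] using this
  rw [← inner_conj_symm]
  have h3 := h1.unique h2
  rw [innerSL_apply_apply] at h3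
  rw [h3, Complex.conj_conj]

/-- A ring endomorphism of `ℂ` that makes all the functions `x ↦ τ ⟪z, T x⟫` bounded, for some
surjective `T`, is continuous. -/
theorem continuous_ringHom_of_bound (hH : ¬ FiniteDimensional ℂ H) (τ : ℂ →+* ℂ) {T : H → H}
    (hT : Function.Surjective T) (h : ∀ z, ∃ C : ℝ, ∀ x, ‖τ ⟪z, T x⟫_ℂ‖ ≤ C * ‖x‖) :
    Continuous τ := by
  by_contra hτ
  have hunb : ∀ δ M : ℝ, 0 < δ → ∃ a : ℂ, ‖a‖ ≤ δ ∧ M < ‖τ a‖ := by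
    intro δ M hδ
    by_contra! hb
    refine hτ (AddMonoidHom.continuous_of_isBounded_nhds_zero τ.toAddMonoidHom
      (Metric.closedBall_mem_nhds 0 hδ) ?_)
    rw [isBounded_iff_forall_norm_le]
    refine ⟨M, ?_⟩
    rintro _ ⟨a, ha, rfl⟩
    exact hb a (by simpa using ha)
  obtain ⟨e, he⟩ := exists_orthonormal_nat hH
  choose x hx using fun n => hT (e n)
  -- Gliding hump: a single y with ⟨y, e_n⟩ = a_n makes |τ⟨y, T x_n⟩| exceed n‖x_n‖ for every n.
  choose a ha hla using fun n : ℕ => hunb ((1 / 2) ^ n) (n * ‖x n‖ + n) (by positivity)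
  obtain ⟨y, hy⟩ := exists_inner_eq_of_orthonormal he ha
  obtain ⟨C, hC⟩ := h y
  obtain ⟨n, hn⟩ := exists_nat_ge C
  have h1 := hC (x n)
  rw [hx, hy] at h1
  have h2 := hla n
  have h3 : C * ‖x n‖ ≤ n * ‖x n‖ := by gcongr
  have h4 : (0 : ℝ) ≤ n := Nat.cast_nonneg n
  linarith

theorem continuous_of_inner_continuous {T : H →ₗ[ℝ] H}
    (h : ∀ z, Continuous fun x => ⟪z, T x⟫_ℂ) : Continuous T := by
  refine T.continuous_of_seq_closed_graph fun x v y hx hy => ?_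
  refine ext_inner_left ℂ fun z => ?_
  exact tendsto_nhds_unique (tendsto_const_nhds.inner hy) (((h z).tendsto v).comp hx)

/-- A semilinear bijection that carries root ranges onto root ranges is continuous, and its
automorphism is the identity or the conjugation. -/
theorem continuous_semilinear_of_rootRange (hH : ¬ FiniteDimensional ℂ H)
    {φ : PosOp H → PosOp H} (hφ : Function.Surjective φ) {σ : ℂ ≃+* ℂ} {T : H ≃+ H}
    (hsmul : ∀ (c : ℂ) (x : H), T (c • x) = σ c • T x)
    (h : ∀ (A : PosOp H) (x : H), T x ∈ rootRange (φ A) ↔ x ∈ rootRange A) :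
    Continuous T ∧ ((∀ c, σ c = c) ∨ ∀ c, σ c = conj c) := by
  let f : H → H →ₗ[ℂ] ℂ := fun z =>
    { toFun := fun x => σ.symm ⟪z, T x⟫_ℂ
      map_add' := fun x y => by rw [map_add, inner_add_right, map_add]
      map_smul' := fun c x => by
        rw [hsmul, inner_smul_right, map_mul, σ.symm_apply_apply, RingHom.id_apply, smul_eq_mul] }
  have hf : ∀ z, Continuous (f z) := by
    intro z
    -- z^⊥ is a root range, so its preimage under T, which is the kernel of `f z`, is ran √B.
    obtain ⟨B, hB⟩ := hφ (projOp (ℂ ∙ z)ᗮ)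
    refine continuous_of_ker_eq_range (S := opSqrt B.1) fun x => ?_
    have h1 := h B x
    rw [hB, rootRange_projOp, Submodule.mem_orthogonal_singleton_iff_inner_right] at h1
    rw [← rootRange, ← h1]
    exact map_eq_zero_iff σ.symm σ.symm.injective
  have hσc : Continuous σ.symm.toRingHom := by
    refine continuous_ringHom_of_bound hH _ T.surjective fun z => ?_
    exact ⟨_, (⟨f z, hf z⟩ : H →L[ℂ] ℂ).le_opNorm⟩
  have hσ' : (∀ c, σ.symm c = c) ∨ ∀ c, σ.symm c = conj c := by
    rcases Complex.ringHom_eq_id_or_conj_of_continuous hσc with h1 | h1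
    · exact Or.inl fun c => DFunLike.congr_fun h1 c
    · exact Or.inr fun c => DFunLike.congr_fun h1 c
  have hσ : (∀ c, σ c = c) ∨ ∀ c, σ c = conj c := by
    refine hσ'.imp (fun h1 c => ?_) fun h1 c => ?_
    · rw [← h1 (σ c), σ.symm_apply_apply]
    · rw [← Complex.conj_conj (σ c), ← h1 (σ c), σ.symm_apply_apply]
  have hσcont : Continuous σ := by
    rcases hσ with h1 | h1
    · exact continuous_id.congr fun c => (h1 c).symm
    · exact Complex.continuous_conj.congr fun c => (h1 c).symm
  refine ⟨?_, hσ⟩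
  let T' : H →ₗ[ℝ] H :=
    { toFun := T
      map_add' := map_add T
      map_smul' := fun r x => by
        rw [← Complex.coe_smul, hsmul, RingHom.id_apply, ← Complex.coe_smul]
        rcases hσ with h1 | h1
        · rw [h1]
        · rw [h1, Complex.conj_ofReal] }
  refine continuous_of_inner_continuous (T := T') fun z => ?_
  refine (hσcont.comp (hf z)).congr fun x => ?_
  exact σ.apply_symm_apply _

/-- A bijection that preserves inclusion of root ranges is induced by a bounded invertible operator,
linear or conjugate-linear. -/
theorem exists_continuousLinearEquiv_of_rootRange_le_iff (hH : ¬ FiniteDimensional ℂ H)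
    {φ : PosOp H → PosOp H} (hφ : Function.Bijective φ)
    (h : ∀ A B : PosOp H, rootRange A ≤ rootRange B ↔ rootRange (φ A) ≤ rootRange (φ B)) :
    (∃ T : H ≃L[ℂ] H, ∀ A : PosOp H, (rootRange (φ A) : Set H) = T '' rootRange A) ∨
      ∃ T : H ≃L⋆[ℂ] H, ∀ A : PosOp H, (rootRange (φ A) : Set H) = T '' rootRange A := by
  obtain ⟨σ, T, hsmul, hmem⟩ := exists_semilinear_of_rootRange_le_iff hH hφ h
  obtain ⟨hT, hσ⟩ := continuous_semilinear_of_rootRange hH hφ.2 hsmul hmem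
  have himage : ∀ A : PosOp H, (rootRange (φ A) : Set H) = T '' rootRange A := by
    intro A
    ext y
    obtain ⟨x, rfl⟩ := T.surjective y
    rw [T.injective.mem_set_image]
    exact hmem A x
  refine hσ.imp (fun hσ => ?_) fun hσ => ?_
  · let e : H ≃ₗ[ℂ] H := { T with map_smul' := fun c x => (hsmul c x).trans (by rw [hσ]; rfl) }
    exact ⟨e.toContinuousLinearEquivOfContinuous hT, himage⟩
  · let e : H ≃ₗ⋆[ℂ] H := { T with map_smul' := fun c x => (hsmul c x).trans (by rw [hσ]; rfl) }
    exact ⟨e.toContinuousLinearEquivOfContinuous hT, himage⟩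

end Continuity

/-! ### Root ranges of TAT* and the converse implications. -/

section Congruence

variable {H : Type*} [NormedAddCommGroup H] [InnerProductSpace ℂ H] [CompleteSpace H]

/-- The functional criterion `mem_rootRange_iff` is substituted along the adjoint T'. Only absolute
values of inner products enter, which covers linear and conjugate-linear T at once. -/
theorem rootRange_eq_image {T T' : H → H} (hT : Function.Bijective T)
    (hT' : Function.Surjective T') (hadj : ∀ x y, ‖⟪T x, y⟫_ℂ‖ = ‖⟪x, T' y⟫_ℂ‖) {A A' : PosOp H}
    (h : ∀ z, ‖opSqrt A'.1 z‖ = ‖opSqrt A.1 (T' z)‖) :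
    (rootRange A' : Set H) = T '' rootRange A := by
  ext y
  obtain ⟨x, rfl⟩ := hT.2 y
  rw [hT.1.mem_set_image, SetLike.mem_coe, SetLike.mem_coe, mem_rootRange_iff, mem_rootRange_iff]
  refine exists_congr fun c => ?_
  rw [hT'.forall (p := fun z => ‖⟪x, z⟫_ℂ‖ ≤ c * ‖opSqrt A.1 z‖)]
  simp only [hadj, h]

theorem FormClosable.of_norm_le {A B A' B' : PosOp H} (h : FormClosable A B) (T : H →+ H)
    {a b c : ℝ}
    (hA : ∀ z, ‖opSqrt A'.1 z‖ ≤ a * ‖opSqrt A.1 (T z)‖)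
    (hA' : ∀ z, ‖opSqrt A.1 (T z)‖ ≤ b * ‖opSqrt A'.1 z‖)
    (hB : ∀ z, ‖opSqrt B.1 (T z)‖ ≤ c * ‖opSqrt B'.1 z‖) : FormClosable A' B' := by
  intro z hz hcauchy
  refine squeeze_zero_norm (fun n => hA (z n)) ?_
  have h1 : Tendsto (fun n => opSqrt B.1 (T (z n))) atTop (𝓝 0) :=
    squeeze_zero_norm (fun n => hB (z n)) (by simpa using hz.norm.const_mul c)
  have h2 : CauchySeq fun n => opSqrt A.1 (T (z n)) := by
    rw [Metric.cauchySeq_iff] at hcauchy ⊢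
    intro ε hε
    have hb : 0 < |b| + 1 := by positivity
    obtain ⟨N, hN⟩ := hcauchy (ε / (|b| + 1)) (by positivity)
    refine ⟨N, fun m hm n hn => ?_⟩
    have h3 := hN m hm n hn
    rw [dist_eq_norm, ← map_sub, lt_div_iff₀ hb] at h3
    rw [dist_eq_norm, ← map_sub, ← map_sub]
    refine (hA' _).trans_lt (lt_of_le_of_lt ?_ h3)
    rw [mul_comm]
    exact mul_le_mul_of_nonneg_left ((le_abs_self b).trans (by linarith)) (norm_nonneg _)
  simpa using (h _ h1 h2).norm.const_mul a

theorem exists_norm_opSqrt_le {A B : PosOp H} (h : rootRange A ≤ rootRange B) :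
    ∃ c : ℝ, 0 ≤ c ∧ ∀ x, ‖opSqrt A.1 x‖ ≤ c * ‖opSqrt B.1 x‖ :=
  (dominated_iff_norm_le A B).1 (dominated_iff_rootRange_le.2 h)

/-- Meant for the adjoint in the role of T, with A' = TAT* and A₁ = φ(A). Equal root ranges give
equivalent seminorms, which leave closability unchanged. -/
theorem absCont_iff_of_norm_eq {A B A' B' A₁ B₁ : PosOp H} (T : H ≃+ H)
    (hA : ∀ z, ‖opSqrt A'.1 z‖ = ‖opSqrt A.1 (T z)‖)
    (hB : ∀ z, ‖opSqrt B'.1 z‖ = ‖opSqrt B.1 (T z)‖)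
    (hA₁ : rootRange A₁ = rootRange A') (hB₁ : rootRange B₁ = rootRange B') :
    AbsCont A B ↔ AbsCont A₁ B₁ := by
  rw [absCont_iff_formClosable, absCont_iff_formClosable]
  obtain ⟨a, -, ha⟩ := exists_norm_opSqrt_le hA₁.le
  obtain ⟨a', -, ha'⟩ := exists_norm_opSqrt_le hA₁.ge
  obtain ⟨b, -, hb⟩ := exists_norm_opSqrt_le hB₁.le
  obtain ⟨b', -, hb'⟩ := exists_norm_opSqrt_le hB₁.ge
  simp only [hA] at ha ha'
  simp only [hB] at hb hb'
  constructor
  · exact fun h => h.of_norm_le T.toAddMonoidHom ha ha' hb'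
  · intro h
    refine h.of_norm_le T.symm.toAddMonoidHom (a := a') (b := a) (c := b) (fun z => ?_)
      (fun z => ?_) fun z => ?_
    · simpa using ha' (T.symm z)
    · simpa using ha (T.symm z)
    · simpa using hb (T.symm z)

/-- Two positive operators have the same root range iff one is `√A Z √A` with `A` the other one
and `Z` positive and invertible. -/
theorem rootRange_eq_iff_exists_isUnit {A B : PosOp H} :
    rootRange B = rootRange A ↔
      ∃ Z : PosOp H, IsUnit Z.1 ∧ B.1 = opSqrt A.1 ∘L Z.1 ∘L opSqrt A.1 := by
  constructor
  · intro h
    obtain ⟨a, ha0, ha⟩ := exists_norm_opSqrt_le h.le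
    obtain ⟨b, hb0, hb⟩ := exists_norm_opSqrt_le h.ge
    -- √A x ↦ √B x extends to V₀ on N, bounded and bounded below. Z is V*V plus the projection onto
    -- N^⊥, which makes Z invertible and is annihilated by √A.
    let N : Submodule ℂ H := (rootRange A).topologicalClosure
    have : CompleteSpace N := (rootRange A).isClosed_topologicalClosure.completeSpace_coe
    have : N.HasOrthogonalProjection := .ofCompleteSpace N
    let e : H →ₗ[ℂ] N := (opSqrt A.1).toLinearMap.codRestrict N
      fun x => (rootRange A).le_topologicalClosure ⟨x, rfl⟩
    have hnorm : ∀ x, ‖e x‖ = ‖opSqrt A.1 x‖ := fun x => rfl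
    have he : DenseRange e := by
      intro n
      rw [closure_subtype, ← Set.range_comp]
      exact n.2
    let V₀ : N →L[ℂ] H := (opSqrt B.1).toLinearMap.extendOfNorm e
    have hV₀ : ∀ x, V₀ (e x) = opSqrt B.1 x := fun x =>
      LinearMap.extendOfNorm_eq he ⟨a, ha⟩ x
    have hV₀b : ∀ n : N, ‖n‖ ≤ b * ‖V₀ n‖ := fun n =>
      he.induction_on (p := fun n => ‖n‖ ≤ b * ‖V₀ n‖) n
        (isClosed_le continuous_norm (V₀.continuous.norm.const_smul b))
        fun x => by
          rw [hV₀]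
          exact hb x
    let V : H →L[ℂ] H := V₀ ∘L N.orthogonalProjectionOnto
    have hVA : ∀ x, V (opSqrt A.1 x) = opSqrt B.1 x := fun x => by
      rw [← hV₀]
      exact congrArg V₀ (N.orthogonalProjectionOnto_mem_subspace_eq_self (e x))
    let Q : H →L[ℂ] H := Nᗮ.starProjection
    have hQA : ∀ x, Q (opSqrt A.1 x) = 0 := fun x => by
      rw [Submodule.starProjection_apply_eq_zero_iff]
      exact N.le_orthogonal_orthogonal (e x).2
    have hQ : Q.IsPositive :=
      ContinuousLinearMap.IsPositive.of_isStarProjection isStarProjection_starProjection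
    have hZ : (ContinuousLinearMap.adjoint V ∘L V + Q).IsPositive :=
      (ContinuousLinearMap.isPositive_adjoint_comp_self V).add hQ
    have hZinner : ∀ x, (⟪(ContinuousLinearMap.adjoint V ∘L V + Q) x, x⟫_ℂ).re =
        ‖V x‖ ^ 2 + ‖Q x‖ ^ 2 := fun x => by
      rw [add_apply, inner_add_left, Complex.add_re, ContinuousLinearMap.comp_apply,
        ContinuousLinearMap.adjoint_inner_left, ← RCLike.re_to_complex, inner_self_eq_norm_sq]
      exact congrArg _ (Nᗮ.re_inner_starProjection_eq_normSq x)
    refine ⟨⟨_, hZ⟩, ?_, ?_⟩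
    -- ‖x‖² ≤ b²‖Vx‖² + ‖Qx‖² ≤ (b² + 1)⟨Zx, x⟩.
    · have hc : 0 < (b ^ 2 + 1)⁻¹ := by positivity
      refine ContinuousLinearMap.isUnit_of_forall_le_norm_inner_map _ (c := ⟨_, hc.le⟩) hc
        fun x => ?_
      refine le_trans ?_ (Complex.re_le_norm _)
      rw [hZinner]
      change ‖x‖ ^ 2 * (b ^ 2 + 1)⁻¹ ≤ _
      rw [← div_eq_mul_inv, div_le_iff₀ (by positivity), N.norm_sq_eq_add_norm_sq_starProjection x]
      have h1 : ‖N.starProjection x‖ ^ 2 ≤ b ^ 2 * ‖V x‖ ^ 2 := by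
        rw [← mul_pow]
        exact pow_le_pow_left₀ (norm_nonneg _) (hV₀b (N.orthogonalProjectionOnto x)) 2
      change _ + ‖Q x‖ ^ 2 ≤ _
      nlinarith [sq_nonneg ‖V x‖, sq_nonneg (b * ‖Q x‖)]
    · ext x
      simp only [ContinuousLinearMap.comp_apply, add_apply, hQA, hVA, add_zero]
      refine ext_inner_right ℂ fun y => ?_
      rw [inner_opSqrt_left, ContinuousLinearMap.adjoint_inner_left, hVA, ← inner_opSqrt_left,
        opSqrt_opSqrt B.2]
  · rintro ⟨Z, hZ, hB⟩
    have hR : IsUnit (opSqrt Z.1) :=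
      (CFC.isUnit_sqrt_iff Z.1 ((ContinuousLinearMap.nonneg_iff_isPositive _).2 Z.2)).2 hZ
    obtain ⟨R, hR⟩ := hR
    have hnorm : ∀ x, ‖opSqrt B.1 x‖ = ‖opSqrt Z.1 (opSqrt A.1 x)‖ := fun x => by
      rw [← sq_eq_sq₀ (norm_nonneg _) (norm_nonneg _), norm_opSqrt_sq B.2, norm_opSqrt_sq Z.2, hB,
        ContinuousLinearMap.comp_apply, inner_opSqrt_left, ContinuousLinearMap.comp_apply]
    apply le_antisymm <;> rw [← dominated_iff_rootRange_le, dominated_iff_norm_le]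
    · exact ⟨‖opSqrt Z.1‖, norm_nonneg _, fun x => (hnorm x).trans_le
        (ContinuousLinearMap.le_opNorm _ _)⟩
    · refine ⟨‖(↑R⁻¹ : H →L[ℂ] H)‖, norm_nonneg _, fun x => ?_⟩
      have h1 : (↑R⁻¹ : H →L[ℂ] H) (opSqrt Z.1 (opSqrt A.1 x)) = opSqrt A.1 x := by
        rw [← hR]
        exact DFunLike.congr_fun R.inv_mul (opSqrt A.1 x)
      rw [hnorm]
      conv_lhs => rw [← h1]
      exact ContinuousLinearMap.le_opNorm _ _

/-- The adjoint of a bounded invertible linear operator as an additive equivalence. -/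
def adjointAddEquiv (T : H ≃L[ℂ] H) : H ≃+ H where
  toFun := ContinuousLinearMap.adjoint (T : H →L[ℂ] H)
  invFun := ContinuousLinearMap.adjoint (T.symm : H →L[ℂ] H)
  left_inv y := ext_inner_right ℂ fun x => by simp [ContinuousLinearMap.adjoint_inner_left]
  right_inv y := ext_inner_right ℂ fun x => by simp [ContinuousLinearMap.adjoint_inner_left]
  map_add' := map_add _

theorem conjAdjoint_inner_right (T : H →L⋆[ℂ] H) (x y : H) :
    ⟪x, conjAdjoint T y⟫_ℂ = ⟪y, T x⟫_ℂ := by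
  rw [← inner_conj_symm, conjAdjoint_inner, inner_conj_symm]

/-- The adjoint of a bounded invertible conjugate-linear operator as an additive equivalence. -/
def conjAdjointAddEquiv (T : H ≃L⋆[ℂ] H) : H ≃+ H where
  toFun := conjAdjoint (T : H →L⋆[ℂ] H)
  invFun := conjAdjoint (T.symm : H →L⋆[ℂ] H)
  left_inv y := ext_inner_right ℂ fun x => by
    rw [conjAdjoint_inner, conjAdjoint_inner_right]
    simp
  right_inv y := ext_inner_right ℂ fun x => by
    rw [conjAdjoint_inner, conjAdjoint_inner_right]
    simp
  map_add' := map_add _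

/-- `T A T*` as a positive operator, for linear `T`. -/
def conjugateLinPos (T : H →L[ℂ] H) (A : PosOp H) : PosOp H :=
  ⟨conjugateLin T A.1, A.2.conj_adjoint T⟩

theorem inner_conjugateConj (T : H →L⋆[ℂ] H) (A : H →L[ℂ] H) (z : H) :
    ⟪conjugateConj T A z, z⟫_ℂ = ⟪conjAdjoint T z, A (conjAdjoint T z)⟫_ℂ := by
  rw [conjAdjoint_inner]
  rfl

/-- `T A T*` as a positive operator, for conjugate-linear `T`. -/
def conjugateConjPos (T : H →L⋆[ℂ] H) (A : PosOp H) : PosOp H :=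
  ⟨conjugateConj T A.1, by
    rw [ContinuousLinearMap.isPositive_iff_complex]
    intro z
    have h := A.2.inner_nonneg_right (conjAdjoint T z)
    rw [← inner_conjugateConj] at h
    obtain ⟨h1, h2⟩ := Complex.nonneg_iff.1 h
    exact ⟨Complex.ext rfl h2, h1⟩⟩

theorem norm_opSqrt_conjugateLinPos (T : H →L[ℂ] H) (A : PosOp H) (z : H) :
    ‖opSqrt (conjugateLinPos T A).1 z‖ = ‖opSqrt A.1 (ContinuousLinearMap.adjoint T z)‖ := by
  rw [← sq_eq_sq₀ (norm_nonneg _) (norm_nonneg _), norm_opSqrt_sq (conjugateLinPos T A).2,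
    norm_opSqrt_sq A.2, ContinuousLinearMap.adjoint_inner_right]
  rfl

theorem norm_opSqrt_conjugateConjPos (T : H →L⋆[ℂ] H) (A : PosOp H) (z : H) :
    ‖opSqrt (conjugateConjPos T A).1 z‖ = ‖opSqrt A.1 (conjAdjoint T z)‖ := by
  rw [← sq_eq_sq₀ (norm_nonneg _) (norm_nonneg _), norm_opSqrt_sq (conjugateConjPos T A).2,
    norm_opSqrt_sq A.2, A.2.inner_left_eq_inner_right]
  exact congrArg Complex.re (inner_conjugateConj T A.1 z)

theorem rootRange_conjugateLinPos (T : H ≃L[ℂ] H) (A : PosOp H) :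
    (rootRange (conjugateLinPos (T : H →L[ℂ] H) A) : Set H) = T '' rootRange A :=
  rootRange_eq_image T.bijective (adjointAddEquiv T).surjective
    (fun x y => congrArg norm (ContinuousLinearMap.adjoint_inner_right (T : H →L[ℂ] H) x y).symm)
    (norm_opSqrt_conjugateLinPos _ A)

theorem rootRange_conjugateConjPos (T : H ≃L⋆[ℂ] H) (A : PosOp H) :
    (rootRange (conjugateConjPos (T : H →L⋆[ℂ] H) A) : Set H) = T '' rootRange A :=
  rootRange_eq_image T.bijective (conjAdjointAddEquiv T).surjective
    (fun x y => (norm_inner_symm _ _).trans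
      (congrArg norm (conjAdjoint_inner_right (T : H →L⋆[ℂ] H) x y).symm))
    (norm_opSqrt_conjugateConjPos _ A)

theorem singular_iff_of_rootRange_eq_image {T : H → H} (hT : Function.Injective T) (hT0 : T 0 = 0)
    {A B A₁ B₁ : PosOp H} (hA : (rootRange A₁ : Set H) = T '' rootRange A)
    (hB : (rootRange B₁ : Set H) = T '' rootRange B) : Singular A B ↔ Singular A₁ B₁ := by
  rw [singular_iff_disjoint, singular_iff_disjoint, Submodule.disjoint_def, Submodule.disjoint_def]
  simp only [← SetLike.mem_coe, hA, hB]
  constructor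
  · rintro h _ ⟨x, hx, rfl⟩ hx'
    rw [h x hx (hT.mem_set_image.1 hx'), hT0]
  · intro h x hxA hxB
    exact hT ((h _ ⟨x, hxA, rfl⟩ ⟨x, hxB, rfl⟩).trans hT0.symm)

theorem range_opSqrt_eq_iff {T : H → H} {A B : PosOp H} :
    Set.range (opSqrt B.1) = Set.range (fun x => T (opSqrt A.1 x)) ↔
      (rootRange B : Set H) = T '' rootRange A := by
  rw [coe_rootRange, coe_rootRange, ← Set.range_comp]
  rfl

end Congruence

end

/-! ### The equivalence. -/

theorem theorem3p1 {H : Type*} [NormedAddCommGroup H] [InnerProductSpace ℂ H] [CompleteSpace H]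
    (hH : ¬ FiniteDimensional ℂ H) (φ : PosOp H → PosOp H) (hφ : Function.Bijective φ) :
    List.TFAE [
      -- (i) absolute continuity is preserved in both directions
      ∀ A B : PosOp H, AbsCont A B ↔ AbsCont (φ A) (φ B),
      -- (ii) singularity is preserved in both directions
      ∀ A B : PosOp H, Singular A B ↔ Singular (φ A) (φ B),
      -- (iii) `T` is bounded, invertible, and linear or conjugate-linear
      (∃ T : H ≃L[ℂ] H, ∀ A : PosOp H,
          Set.range (opSqrt (φ A).1) = Set.range (fun x => T (opSqrt A.1 x))) ∨
        (∃ T : H ≃L⋆[ℂ] H, ∀ A : PosOp H,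
          Set.range (opSqrt (φ A).1) = Set.range (fun x => T (opSqrt A.1 x))),
      -- (iv) the same kind of `T`, and a family `Z` of invertible positive operators
      (∃ (T : H ≃L[ℂ] H) (Z : PosOp H → PosOp H), ∀ A : PosOp H, IsUnit (Z A).1 ∧
          (φ A).1 = opSqrt (conjugateLin (T : H →L[ℂ] H) A.1) ∘L (Z A).1 ∘L
            opSqrt (conjugateLin (T : H →L[ℂ] H) A.1)) ∨
        (∃ (T : H ≃L⋆[ℂ] H) (Z : PosOp H → PosOp H), ∀ A : PosOp H, IsUnit (Z A).1 ∧
          (φ A).1 = opSqrt (conjugateConj (T : H →L⋆[ℂ] H) A.1) ∘L (Z A).1 ∘L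
            opSqrt (conjugateConj (T : H →L⋆[ℂ] H) A.1))] := by
  simp only [range_opSqrt_eq_iff]
  tfae_have 1 → 3 := fun h => exists_continuousLinearEquiv_of_rootRange_le_iff hH hφ
    (rootRange_le_iff_of_absCont hφ.2 h)
  tfae_have 2 → 3 := fun h => exists_continuousLinearEquiv_of_rootRange_le_iff hH hφ
    (rootRange_le_iff_of_singular hφ.2 h)
  tfae_have 3 → 1 := by
    rintro (⟨T, hT⟩ | ⟨T, hT⟩) A B
    · have hR : ∀ A, rootRange (φ A) = rootRange (conjugateLinPos (T : H →L[ℂ] H) A) := fun A =>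
        SetLike.coe_injective ((hT A).trans (rootRange_conjugateLinPos T A).symm)
      exact absCont_iff_of_norm_eq (adjointAddEquiv T) (norm_opSqrt_conjugateLinPos _ A)
        (norm_opSqrt_conjugateLinPos _ B) (hR A) (hR B)
    · have hR : ∀ A, rootRange (φ A) = rootRange (conjugateConjPos (T : H →L⋆[ℂ] H) A) := fun A =>
        SetLike.coe_injective ((hT A).trans (rootRange_conjugateConjPos T A).symm)
      exact absCont_iff_of_norm_eq (conjAdjointAddEquiv T) (norm_opSqrt_conjugateConjPos _ A)
        (norm_opSqrt_conjugateConjPos _ B) (hR A) (hR B)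
  tfae_have 3 → 2 := by
    rintro (⟨T, hT⟩ | ⟨T, hT⟩) A B
    · exact singular_iff_of_rootRange_eq_image T.injective (map_zero T) (hT A) (hT B)
    · exact singular_iff_of_rootRange_eq_image T.injective (map_zero T) (hT A) (hT B)
  tfae_have 3 ↔ 4 := by
    refine or_congr (exists_congr fun T => ?_) (exists_congr fun T => ?_)
    -- The family `Z` becomes a separate existence claim for each A, to which
    -- `rootRange_eq_iff_exists_isUnit` applies with TAT* as base operator.
    · rw [← Classical.skolem (p := fun A (Z : PosOp H) => IsUnit Z.1 ∧ (φ A).1 =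
        opSqrt (conjugateLin (T : H →L[ℂ] H) A.1) ∘L Z.1 ∘L
          opSqrt (conjugateLin (T : H →L[ℂ] H) A.1))]
      refine forall_congr' fun A => ?_
      rw [← rootRange_conjugateLinPos, SetLike.coe_set_eq, rootRange_eq_iff_exists_isUnit]
      rfl
    · rw [← Classical.skolem (p := fun A (Z : PosOp H) => IsUnit Z.1 ∧ (φ A).1 =
        opSqrt (conjugateConj (T : H →L⋆[ℂ] H) A.1) ∘L Z.1 ∘L
          opSqrt (conjugateConj (T : H →L⋆[ℂ] H) A.1))]
      refine forall_congr' fun A => ?_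
      rw [← rootRange_conjugateConjPos, SetLike.coe_set_eq, rootRange_eq_iff_exists_isUnit]
      rfl
  tfae_finish
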